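/- **Theorem (Partition Sieving).** Let $X=\{x_1,\dots,x_n\}$ be partitioned as $X = X_1\sqcup\dots\sqcup X_p$, and let $c_1,\dots,c_p\ge 1$ be integers with $c_1+\dots+c_p=d$. Let $\mathcal M$ be the partition matroid on $X$ in which $S\subseteq X$ is independent if and only if $|S\cap X_i|\le c_i$ for all $i$, and suppose that $\mathcal M$ has rank $d$. Let $\mathbb F$ be a finite field of characteristic $2$ with $|\mathbb F|>d$, and let $P\in\mathbb F[x_1,\dots,x_n]$ be homogeneous of degree $d$ (possibly zero) and compatible with $\mathcal M$: every monomial that appears in $P$ has degree exactly $c_i$ in the variables of $X_i$, for each $i$. The input consists of $n$, $p$, the partition, the capacities, and oracle access to $P$: a program may ask for the value of $P$ at a point of $\mathbb F^n$. For every constant $a\ge 0$ there are a randomized algorithm and constants $C,k$, all independent of $\mathbb F$ and of the input, such that on every such input and for all outcomes of the random choices, the algorithm runs in time at most $C(n+1)^k\,2^{d-p}$ (that is, $O^*(2^{d-p})$) and uses at most $C(n+1+\log|\mathbb F|)^k$ bits of memory (polynomial space), and with probability at least $1-(n+2)^{-a}$ it correctly determines whether some monomial $\mathbf m$ that appears in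 $P$ has a support $\operatorname{supp}(\mathbf m)$ that is a basis of $\mathcal M$. Here algorithms are programs for a random access machine on which each of the following is one time step: an integer operation, an arithmetic operation in $\mathbb F$, drawing a uniformly random element of $\mathbb F$, and an evaluation of $P$. Field elements are stored through an arbitrary numbering of $\mathbb F$ by $0,\dots,|\mathbb F|-1$, and $\log|\mathbb F|$ denotes the number of binary digits of $|\mathbb F|$. -/

import Mathlib

/-! ### Partition matroids and compatible polynomials -/

/-- The partition matroid on the index set `Fin n` of the variables. The parts are the fibres
`X_i = cls ⁻¹ {i}` for `i : Fin p`, with capacities `c i`: a set is independent if and only if it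
has at most `c i` elements in the part `X_i`, for every `i`. -/
def partitionMatroid {n p : ℕ} (cls : Fin n → Fin p) (c : Fin p → ℕ) : Matroid (Fin n) :=
  (IndepMatroid.ofFinset Set.univ
    (fun I : Finset (Fin n) => ∀ i, (I.filter fun x => cls x = i).card ≤ c i)
    (fun i => by simp)
    (fun I J hJ hIJ i =>
      (Finset.card_le_card (Finset.filter_subset_filter _ hIJ)).trans (hJ i))
    (fun I J hI hJ hlt => by
      classical
      -- some part contains more elements of `J` than of `I`
      obtain ⟨i, hi⟩ : ∃ i, (I.filter fun x => cls x = i).card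
          < (J.filter fun x => cls x = i).card := by
        by_contra hcon
        push Not at hcon
        have hsum : ∀ K : Finset (Fin n),
            K.card = ∑ i, (K.filter fun x => cls x = i).card := fun K =>
          Finset.card_eq_sum_card_fiberwise (fun x _ => by simp)
        have := Finset.sum_le_sum (fun i (_ : i ∈ Finset.univ) => hcon i)
        rw [← hsum, ← hsum] at this
        omega
      obtain ⟨e, heJ, heI⟩ := Finset.exists_mem_notMem_of_card_lt_card hi
      rw [Finset.mem_filter] at heJ heI
      have heI' : e ∉ I := fun h => heI ⟨h, heJ.2⟩
      refine ⟨e, heJ.1, heI', fun j => ?_⟩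
      rw [Finset.filter_insert]
      split_ifs with h
      · obtain rfl : i = j := heJ.2.symm.trans h
        rw [Finset.card_insert_of_notMem (by simp [heI'])]
        exact hi.trans_le (hJ i)
      · exact hI j)
    (fun _ _ => Set.subset_univ _)).matroid

theorem partitionMatroid_indep_iff {n p : ℕ} (cls : Fin n → Fin p) (c : Fin p → ℕ)
    (I : Finset (Fin n)) :
    (partitionMatroid cls c).Indep I ↔ ∀ i, (I.filter fun x => cls x = i).card ≤ c i := by
  simp [partitionMatroid]

/-- `P` is compatible with the partition matroid of `cls` and `c`: all capacities are at least
`1`, and every monomial of `P` has degree exactly `c i` in the variables of the part `X_i`. -/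
def Compatible {F : Type*} [CommSemiring F] {n p : ℕ} (P : MvPolynomial (Fin n) F)
    (cls : Fin n → Fin p) (c : Fin p → ℕ) : Prop :=
  (∀ i, 1 ≤ c i) ∧ ∀ m ∈ P.support, ∀ i, ∑ x with cls x = i, m x = c i

/-! ### The machine model

A program runs on a random access memory that holds natural numbers. It can do integer
arithmetic, arithmetic in a finite field `F`, draw uniformly random elements of `F`, and ask an
oracle for the value of the input polynomial at a point. Field elements are stored through an
arbitrary numbering of `F` by `0, …, |F| - 1`. Every operation counts as one time step, and space
is the number of bits of the memory contents. Programs are fixed finite syntax trees, so an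
algorithm is uniform in the input and in the field. -/

/-- The memory: cell `(a, j)` is entry `j` of array number `a`. Cells never written hold `0`. -/
abbrev Memory := (ℕ × ℕ) →₀ ℕ

/-- The number of bits of a memory: every nonzero cell is charged for its address and its
contents (and one more bit). -/
def Memory.bits (M : Memory) : ℕ :=
  M.sum fun a v => a.1.size + a.2.size + v.size + 1

/-- What a program has access to besides its memory: a finite field, a numbering of the field
elements, and the polynomial, which can be evaluated only. -/
structure Oracle (F : Type*) [Field F] [Fintype F] (n : ℕ) where
  code : F ≃ Fin (Fintype.card F)
  poly : MvPolynomial (Fin n) F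

namespace Oracle

variable {F : Type*} [Field F] [Fintype F] {n : ℕ}

/-- The number that represents a field element. -/
def enc (O : Oracle F n) (x : F) : ℕ := (O.code x : ℕ)

/-- The field element that a number represents (`0` if it represents none). -/
def dec (O : Oracle F n) (v : ℕ) : F :=
  if h : v < Fintype.card F then O.code.symm ⟨v, h⟩ else 0

end Oracle

/-- Expressions. `get a e` reads entry `e` of array `a`; `add`, `sub` (truncated), `mul`, `div`
(rounded down) are integer operations; `fzero`, `fone`, `fadd`, `fmul`, `finv` are operations of
the field (`0⁻¹ = 0`); `peval a` is the value of the polynomial at the point whose coordinates are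
the first `n` entries of array `a`. -/
inductive Expr where
  | const (k : ℕ)
  | get (a : ℕ) (e : Expr)
  | add (e f : Expr)
  | sub (e f : Expr)
  | mul (e f : Expr)
  | div (e f : Expr)
  | fzero
  | fone
  | fadd (e f : Expr)
  | fmul (e f : Expr)
  | finv (e : Expr)
  | peval (a : ℕ)

namespace Expr

variable {F : Type*} [Field F] [Fintype F] {n : ℕ}

/-- The value of an expression. -/
noncomputable def eval (O : Oracle F n) (M : Memory) : Expr → ℕ
  | const k => k
  | get a e => M (a, e.eval O M)
  | add e f => e.eval O M + f.eval O M
  | sub e f => e.eval O M - f.eval O M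
  | mul e f => e.eval O M * f.eval O M
  | div e f => e.eval O M / f.eval O M
  | fzero => O.enc 0
  | fone => O.enc 1
  | fadd e f => O.enc (O.dec (e.eval O M) + O.dec (f.eval O M))
  | fmul e f => O.enc (O.dec (e.eval O M) * O.dec (f.eval O M))
  | finv e => O.enc (O.dec (e.eval O M))⁻¹
  | peval a => O.enc (MvPolynomial.eval (fun x : Fin n => O.dec (M (a, (x : ℕ)))) O.poly)

/-- The time to evaluate an expression: its number of operations. -/
def cost : Expr → ℕ
  | const _ => 1
  | get _ e => e.cost + 1
  | add e f => e.cost + f.cost + 1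
  | sub e f => e.cost + f.cost + 1
  | mul e f => e.cost + f.cost + 1
  | div e f => e.cost + f.cost + 1
  | fzero => 1
  | fone => 1
  | fadd e f => e.cost + f.cost + 1
  | fmul e f => e.cost + f.cost + 1
  | finv e => e.cost + 1
  | peval _ => 1

/-- The number of bits of all intermediate values when an expression is evaluated. -/
noncomputable def bits (O : Oracle F n) (M : Memory) : Expr → ℕ
  | const k => k.size
  | get a e => e.bits O M + ((get a e).eval O M).size
  | add e f => e.bits O M + f.bits O M + ((add e f).eval O M).size
  | sub e f => e.bits O M + f.bits O M + ((sub e f).eval O M).size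
  | mul e f => e.bits O M + f.bits O M + ((mul e f).eval O M).size
  | div e f => e.bits O M + f.bits O M + ((div e f).eval O M).size
  | fzero => (fzero.eval O M).size
  | fone => (fone.eval O M).size
  | fadd e f => e.bits O M + f.bits O M + ((fadd e f).eval O M).size
  | fmul e f => e.bits O M + f.bits O M + ((fmul e f).eval O M).size
  | finv e => e.bits O M + ((finv e).eval O M).size
  | peval a => ((peval a).eval O M).size

end Expr

/-- Programs. `set a e f` writes the value of `f` to entry `e` of array `a`; `rand a e` writes a
fresh uniformly random field element to entry `e` of array `a`; `ite e c₁ c₂` runs `c₁` if `e` is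
nonzero and `c₂` otherwise; `loop e c` evaluates `e` once and then runs `c` that many times. -/
inductive Program where
  | skip
  | set (a : ℕ) (e f : Expr)
  | rand (a : ℕ) (e : Expr)
  | seq (c₁ c₂ : Program)
  | ite (e : Expr) (c₁ c₂ : Program)
  | loop (e : Expr) (c : Program)

/-- The memory, together with the number of steps made so far and the largest number of bits in
use so far. -/
structure RunState where
  mem : Memory
  time : ℕ
  space : ℕ

namespace RunState

/-- Record the passing of `t` steps and the use of `b` bits besides the present memory. -/
def charge (s : RunState) (t b : ℕ) : RunState :=
  ⟨s.mem, s.time + t, max s.space (s.mem.bits + b)⟩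

/-- Write `v` to the cell `i`, with `b` bits in use besides the memory. -/
noncomputable def write (s : RunState) (i : ℕ × ℕ) (v b : ℕ) : RunState :=
  ⟨s.mem.update i v, s.time, max s.space (Memory.bits (s.mem.update i v) + b)⟩

/-- Run `f` a given number of times; each round costs one step besides the cost of `f`. -/
noncomputable def repeatRun (f : RunState → PMF RunState) : ℕ → RunState → PMF RunState
  | 0, s => PMF.pure s
  | k + 1, s => (f (s.charge 1 0)).bind (repeatRun f k)

end RunState

namespace Program

variable {F : Type*} [Field F] [Fintype F] {n : ℕ}

/-- The distribution of the final state when the program is run from state `s`. The number `b` is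
the number of bits that the counters of the surrounding loops occupy. -/
noncomputable def run (O : Oracle F n) : Program → ℕ → RunState → PMF RunState
  | skip, b, s => PMF.pure (s.charge 1 b)
  | set a e f, b, s =>
      PMF.pure ((s.charge (e.cost + f.cost + 1) (b + e.bits O s.mem + f.bits O s.mem)).write
        (a, e.eval O s.mem) (f.eval O s.mem) b)
  | rand a e, b, s =>
      (PMF.uniformOfFintype F).bind fun x =>
        PMF.pure ((s.charge (e.cost + 1) (b + e.bits O s.mem)).write
          (a, e.eval O s.mem) (O.enc x) b)
  | seq c₁ c₂, b, s => (c₁.run O b s).bind (c₂.run O b)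
  | ite e c₁ c₂, b, s =>
      if e.eval O s.mem ≠ 0 then c₁.run O b (s.charge (e.cost + 1) (b + e.bits O s.mem))
      else c₂.run O b (s.charge (e.cost + 1) (b + e.bits O s.mem))
  | loop e c, b, s =>
      RunState.repeatRun (c.run O (b + (e.eval O s.mem).size)) (e.eval O s.mem)
        (s.charge (e.cost + 1) (b + e.bits O s.mem))

end Program

/-- The memory that describes an input: array `0` holds `n` and `p`, array `1` holds the
capacities, and array `2` holds the part to which each variable belongs. -/
noncomputable def inputMemory {n p : ℕ} (cls : Fin n → Fin p) (c : Fin p → ℕ) : Memory :=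
  Finsupp.single (0, 0) n + Finsupp.single (0, 1) p
    + ∑ i : Fin p, Finsupp.single (1, (i : ℕ)) (c i)
    + ∑ x : Fin n, Finsupp.single (2, (x : ℕ)) (cls x : ℕ)

/-- The distribution of the final state of a program on the input given by a partition with
capacities and by oracle access to a polynomial. -/
noncomputable def Program.exec {F : Type*} [Field F] [Fintype F] {n p : ℕ} (A : Program)
    (O : Oracle F n) (cls : Fin n → Fin p) (c : Fin p → ℕ) : PMF RunState :=
  A.run O 0 ⟨inputMemory cls c, 0, (inputMemory cls c).bits⟩

/-- The answer of the program: yes if and only if entry `0` of array `3` is nonzero at the end. -/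
def RunState.saysYes (s : RunState) : Prop := s.mem (3, 0) ≠ 0

/-!
For a compatible polynomial, a monomial has a basis as its support exactly if it is multilinear
(`isBase_support_iff`), so the task is to detect multilinear monomials in characteristic `2`.

*The sieve.* Put `r = d - p` and let every part `X_i` own `c i - 1` of `r` rows; one further row
is common to all parts. Given a matrix with these `r + 1` rows and one column for each variable, a
number `z`, and a subset `I` of the rows, evaluate `P` at the point whose coordinate at a variable
`x` is `z` times its entry in the common row, plus its entries in those rows of `I` that are owned
by the part of `x`. Expand a monomial of degree `d` along the rows. In characteristic `2`, summing
over all `I` leaves the assignments of rows to the `d` factors that use each of the `r` rows; such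
an assignment uses the common row at most `p` times, and extracting the coefficient of `z ^ p` by
interpolation at `p + 1 ≤ d + 1 ≤ |F|` nodes leaves those that use it exactly `p` times
(`sum_prod_sievePoint`). Counting in each part shows that these, if they respect the ownership of
the rows, use distinct rows for distinct factors of the same variable (`Sieved.eq_of_fst_eq`).
Hence exchanging two copies of a variable is an involution without fixed points, and a monomial
that is not multilinear contributes zero (`sieveMonomial_eq_zero`). If there is a multilinear
monomial, unit vectors as columns isolate it (`exists_sieveValue_ne_zero`), so that the sieve is a
nonzero polynomial of degree at most `d` in the matrix entries. By the Schwartz-Zippel lemma a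
random matrix gives the value zero with probability at most `d / |F| ≤ d / (d + 1)`
(`card_sieveValue_eq_zero_le`), and `a (n + 1) (n + 2)` independent rounds bring the probability
of failure below `(n + 2) ^ (-a)` (`failure_pow_le`). The sieve takes `(p + 1) 2 ^ r` evaluations.
It never errs when there is no multilinear monomial.

*The program.* `Program.Ensures` is a Hoare triple that bounds time and space for all random
choices at once. The space bound rests on the invariant `Memory.Bounded`: only polynomially many
cells are in use, and each holds a number with polynomially many bits. The only probabilistic
arguments are that the drawing loop fills the matrix uniformly
(`Program.toOuterMeasure_repeatRun_rand`) and that the rounds are independent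
(`Program.toOuterMeasure_repeatRun_round_le`); everything else a program does is determined by the
memory and is handled by triples.
-/

/-! ### Extraction of coefficients in characteristic two -/

/-- The weight of the node `z k` in the divided difference of order `p` at `z 0, …, z p`, in
characteristic `2`. -/
def lagrangeWeight {F : Type*} [Field F] (p : ℕ) (z : ℕ → F) (k : ℕ) : F :=
  ∏ j ∈ (Finset.range (p + 1)).erase k, (z k + z j)⁻¹

theorem sum_lagrangeWeight_mul_pow {F : Type*} [Field F] [CharP F 2] {p e : ℕ} (z : ℕ → F)
    (hz : Set.InjOn z (Finset.range (p + 1))) (he : e ≤ p) :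
    ∑ k ∈ Finset.range (p + 1), lagrangeWeight p z k * z k ^ e = if e = p then 1 else 0 := by
  have h := Lagrange.coeff_eq_sum (s := Finset.range (p + 1)) (v := z) hz
    (P := (Polynomial.X ^ e : Polynomial F)) (by
      rw [Polynomial.degree_X_pow, Finset.card_range]; exact_mod_cast Nat.lt_succ_of_le he)
  simp only [Polynomial.coeff_X_pow, Finset.card_range, Nat.add_sub_cancel,
    Polynomial.eval_pow, Polynomial.eval_X, eq_comm (a := p)] at h
  rw [h]
  refine Finset.sum_congr rfl fun k _ => ?_
  rw [lagrangeWeight, Finset.prod_inv_distrib, div_eq_mul_inv, mul_comm]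
  simp only [CharTwo.sub_eq_add]

/-- Summing over all subsets of `J` (encoded by their indicator functions) leaves, in
characteristic `2`, only the monomials in which every element of `J` occurs. -/
theorem sum_indicator_prod_pow {F : Type*} [Field F] [CharP F 2] {J : Type*} [Fintype J]
    [DecidableEq J] (e : J → ℕ) [Decidable (∀ j, e j ≠ 0)] :
    ∑ b : J → Fin 2, ∏ j, (if b j = 1 then (1 : F) else 0) ^ e j
      = if ∀ j, e j ≠ 0 then 1 else 0 := by
  have h := Finset.prod_univ_sum (fun _ : J => (Finset.univ : Finset (Fin 2)))
    (fun j v => (if v = 1 then (1 : F) else 0) ^ e j)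
  rw [Fintype.piFinset_univ] at h
  rw [← h]
  have h2 : ∀ j, ∑ v : Fin 2, (if v = 1 then (1 : F) else 0) ^ e j = if e j ≠ 0 then 1 else 0 := by
    intro j
    by_cases hj : e j = 0 <;> simp [hj, CharTwo.two_eq_zero]
  simp_rw [h2]
  by_cases hall : ∀ j, e j ≠ 0
  · simp [hall]
  · rw [if_neg hall]
    push Not at hall
    obtain ⟨j, hj⟩ := hall
    exact Finset.prod_eq_zero (Finset.mem_univ j) (by simp [hj])

/-! ### The sieve -/

/-- The entry of the matrix `g` (stored row by row, with `n` columns) that belongs to a row and a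
variable. Row `none` is the common row `r`; row `some j` is visible only to the variables of the
part `own j`. -/
def sieveRow {F : Type*} [Field F] {n p : ℕ} (cls : Fin n → Fin p) (own : ℕ → ℕ) (r : ℕ)
    (g : ℕ → F) : Option (Fin r) → Fin n → F
  | none, s => g (r * n + s)
  | some j, s => if own j = cls s then g (j * n + s) else 0

/-- The point at which the sieve evaluates the polynomial: the common row is scaled by `z`, and
row `j` takes part if and only if bit `j` of `m` is set. -/
def sievePoint {F : Type*} [Field F] {n p : ℕ} (cls : Fin n → Fin p) (own : ℕ → ℕ) (r : ℕ)
    (g : ℕ → F) (z : F) (m : ℕ) (s : Fin n) : F :=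
  z * g (r * n + s)
    + ∑ j ∈ Finset.range r, if m / 2 ^ j % 2 = 1 ∧ own j = cls s then g (j * n + s) else 0

/-- The sum of the values of `P` over all subsets of the `r` rows, followed by the extraction of
the coefficient of `z ^ p` by interpolation at `z 0, …, z p`. -/
noncomputable def sieveValue {F : Type*} [Field F] {n p : ℕ} (cls : Fin n → Fin p) (own : ℕ → ℕ)
    (r : ℕ) (z : ℕ → F) (P : MvPolynomial (Fin n) F) (g : ℕ → F) : F :=
  ∑ k ∈ Finset.range (p + 1), ∑ m ∈ Finset.range (2 ^ r),
    lagrangeWeight p z k * MvPolynomial.eval (sievePoint cls own r g (z k) m) P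

/-- The factors of the monomial with exponent vector `m`: each variable with its multiplicity. -/
abbrev Factors {n : ℕ} (m : Fin n →₀ ℕ) : Type := (s : Fin n) × Fin (m s)

/-- The assignment `f` of rows to the factors of a monomial uses the common row exactly `p` times
and every other row at least once. -/
def Sieved {n r : ℕ} (p : ℕ) {m : Fin n →₀ ℕ} (f : Factors m → Option (Fin r)) : Prop :=
  (Finset.univ.filter fun t => f t = none).card = p ∧ ∀ j, ∃ t, f t = some j

open Classical in
/-- What the sieve makes of a single monomial: a sum over the assignments of rows to its
factors. -/
noncomputable def sieveMonomial {F : Type*} [Field F] {n p : ℕ} (cls : Fin n → Fin p)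
    (own : ℕ → ℕ) (r : ℕ) (g : ℕ → F) (m : Fin n →₀ ℕ) : F :=
  ∑ f : Factors m → Option (Fin r),
    if Sieved p f then ∏ t, sieveRow cls own r g (f t) t.1 else 0

theorem sievePoint_eq {F : Type*} [Field F] {n p : ℕ} (cls : Fin n → Fin p) (own : ℕ → ℕ) (r : ℕ)
    (g : ℕ → F) (z : F) (m : Fin (2 ^ r)) (s : Fin n) :
    sievePoint cls own r g z m s = ∑ o : Option (Fin r),
      Option.elim o z (fun j => if finFunctionFinEquiv.symm m j = 1 then 1 else 0)
        * sieveRow cls own r g o s := by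
  rw [Fintype.sum_option, sievePoint, Finset.sum_range]
  congr 1
  refine Finset.sum_congr rfl fun j _ => ?_
  have : finFunctionFinEquiv.symm m j = 1 ↔ (m : ℕ) / 2 ^ (j : ℕ) % 2 = 1 := by
    rw [Fin.ext_iff]; rfl
  simp only [Option.elim, sieveRow, this]
  split_ifs <;> simp_all

open Classical in
/-- The sieve, applied to one monomial: expand every factor of the evaluated monomial along the
rows, sum over the subsets of rows, and extract the coefficient of `z ^ p`. -/
theorem sum_prod_sievePoint {F : Type*} [Field F] [CharP F 2] {n p : ℕ} (cls : Fin n → Fin p)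
    (own : ℕ → ℕ) (r : ℕ) (g : ℕ → F) (z : ℕ → F) (hz : Set.InjOn z (Finset.range (p + 1)))
    (m : Fin n →₀ ℕ) (hm : ∑ s, m s = r + p) :
    ∑ k ∈ Finset.range (p + 1), ∑ a ∈ Finset.range (2 ^ r),
      lagrangeWeight p z k * ∏ s, sievePoint cls own r g (z k) a s ^ m s
      = sieveMonomial cls own r g m := by
  have hcard : Fintype.card (Factors m) = r + p := by simp [Factors, hm]
  have hexp : ∀ (y : F) (b : Fin (2 ^ r)),
      ∏ s, sievePoint cls own r g y b s ^ m s
        = ∑ f : Factors m → Option (Fin r),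
          (y ^ (Finset.univ.filter fun t => f t = none).card
            * ∏ j, (if finFunctionFinEquiv.symm b j = 1 then (1 : F) else 0)
              ^ (Finset.univ.filter fun t => f t = some j).card)
            * ∏ t, sieveRow cls own r g (f t) t.1 := by
    intro y b
    have h1 : ∏ s, sievePoint cls own r g y b s ^ m s
        = ∏ t : Factors m, sievePoint cls own r g y b t.1 := by
      rw [Fintype.prod_sigma]
      simp
    rw [h1]
    simp_rw [sievePoint_eq]
    rw [Finset.prod_univ_sum, Fintype.piFinset_univ]
    refine Finset.sum_congr rfl fun f _ => ?_
    rw [Finset.prod_mul_distrib]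
    congr 1
    have h2 := Finset.prod_fiberwise (Finset.univ : Finset (Factors m)) f
      (fun t => (f t).elim y
        (fun j => if finFunctionFinEquiv.symm b j = 1 then (1 : F) else 0))
    rw [← h2, Fintype.prod_option]
    congr 1
    · rw [Finset.prod_congr rfl (g := fun _ => y)]
      · simp
      · intro t ht
        simp [(Finset.mem_filter.1 ht).2]
    · refine Finset.prod_congr rfl fun j _ => ?_
      rw [Finset.prod_congr rfl
        (g := fun _ => if finFunctionFinEquiv.symm b j = 1 then (1 : F) else 0)]
      · simp
      · intro t ht
        simp [(Finset.mem_filter.1 ht).2]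
  have hsum : ∀ k, ∑ a ∈ Finset.range (2 ^ r),
      lagrangeWeight p z k * ∏ s, sievePoint cls own r g (z k) a s ^ m s
      = ∑ f : Factors m → Option (Fin r),
        lagrangeWeight p z k * z k ^ (Finset.univ.filter fun t => f t = none).card *
          ((if ∀ j, (Finset.univ.filter fun t => f t = some j).card ≠ 0 then 1 else 0)
            * ∏ t, sieveRow cls own r g (f t) t.1) := by
    intro k
    rw [Finset.sum_range]
    simp_rw [hexp]
    simp_rw [Finset.mul_sum]
    rw [Finset.sum_comm]
    refine Finset.sum_congr rfl fun f _ => ?_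
    rw [← sum_indicator_prod_pow, ← Equiv.sum_comp finFunctionFinEquiv, Finset.sum_mul,
      Finset.mul_sum]
    refine Finset.sum_congr rfl fun b _ => ?_
    simp only [Equiv.symm_apply_apply]
    ring
  simp_rw [hsum]
  rw [Finset.sum_comm]
  refine Finset.sum_congr rfl fun f _ => ?_
  rw [← Finset.sum_mul]
  by_cases hhit : ∀ j, (Finset.univ.filter fun t => f t = some j).card ≠ 0
  · have hex : ∀ j, ∃ t, f t = some j := fun j => by
      obtain ⟨t, ht⟩ := Finset.card_ne_zero.1 (hhit j)
      exact ⟨t, (Finset.mem_filter.1 ht).2⟩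
    -- all rows `some j` are used, so that at most `p` factors are left for the common row
    have hle : (Finset.univ.filter fun t => f t = none).card ≤ p := by
      have h3 := Finset.card_filter_add_card_filter_not
        (s := (Finset.univ : Finset (Factors m))) (fun t => f t = none)
      rw [Finset.card_univ, hcard] at h3
      choose h hh using hex
      have h4 : Fintype.card (Fin r) ≤ (Finset.univ.filter fun t => ¬ f t = none).card := by
        rw [← Finset.card_univ]
        refine Finset.card_le_card_of_injOn h (fun j _ => by simp [hh]) ?_
        intro i _ j _ hij
        have := hh i
        rw [hij, hh j] at this
        exact (Option.some_injective _ this).symm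
      rw [Fintype.card_fin] at h4
      omega
    rw [sum_lagrangeWeight_mul_pow z hz hle, if_pos hhit]
    by_cases hp : (Finset.univ.filter fun t => f t = none).card = p
    · rw [if_pos hp, if_pos ⟨hp, hex⟩]; simp
    · rw [if_neg hp, if_neg (fun h => hp h.1)]; simp
  · have : ¬ Sieved p f := fun h => hhit fun j => by
      obtain ⟨t, ht⟩ := h.2 j
      exact Finset.card_ne_zero.2 ⟨t, by simp [ht]⟩
    rw [if_neg hhit, if_neg this]
    simp

theorem sieveValue_eq_sum {F : Type*} [Field F] [CharP F 2] {n p : ℕ} (cls : Fin n → Fin p)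
    (own : ℕ → ℕ) (r : ℕ) (g : ℕ → F) (z : ℕ → F) (hz : Set.InjOn z (Finset.range (p + 1)))
    (P : MvPolynomial (Fin n) F) (hP : ∀ m ∈ P.support, ∑ s, m s = r + p) :
    sieveValue cls own r z P g = ∑ m ∈ P.support, P.coeff m * sieveMonomial cls own r g m := by
  have : ∀ k a, lagrangeWeight p z k * MvPolynomial.eval (sievePoint cls own r g (z k) a) P
      = ∑ m ∈ P.support, P.coeff m *
        (lagrangeWeight p z k * ∏ s, sievePoint cls own r g (z k) a s ^ m s) := by
    intro k a
    rw [MvPolynomial.eval_eq', Finset.mul_sum]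
    exact Finset.sum_congr rfl fun m _ => by ring
  simp_rw [sieveValue, this]
  rw [Finset.sum_congr rfl fun k _ => Finset.sum_comm, Finset.sum_comm]
  refine Finset.sum_congr rfl fun m hm => ?_
  rw [← sum_prod_sievePoint cls own r g z hz m (hP m hm), Finset.mul_sum]
  refine Finset.sum_congr rfl fun k _ => ?_
  rw [Finset.mul_sum]

/-- If an assignment contributes to the sieved monomial, it gives distinct rows to distinct copies
of the same variable: each part has at most one factor with the common row, and the other rows
are used once each. -/
theorem Sieved.eq_of_fst_eq {F : Type*} [Field F] {n p : ℕ} {cls : Fin n → Fin p}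
    {own : ℕ → ℕ} {r : ℕ} {g : ℕ → F} {c : Fin p → ℕ} {m : Fin n →₀ ℕ}
    (hown : ∀ i : Fin p, (Finset.univ.filter fun j : Fin r => own j = i).card + 1 = c i)
    (hm : ∀ i, ∑ x with cls x = i, m x = c i) (hmr : ∑ s, m s = r + p)
    {f : Factors m → Option (Fin r)} (hf : Sieved p f)
    (hprod : ∏ t, sieveRow cls own r g (f t) t.1 ≠ 0)
    {t t' : Factors m} (hfst : t.1 = t'.1) (htt : f t = f t') : t = t' := by
  classical
  have hcard : Fintype.card (Factors m) = r + p := by simp [Factors, hmr]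
  obtain ⟨hnone, hsome⟩ := hf
  choose h hh using hsome
  have hinj : Function.Injective h := fun i j hij => by
    have := hh i
    rw [hij, hh j] at this
    exact (Option.some_injective _ this).symm
  have hrow : ∀ j : Fin r, own j = cls (h j).1 := by
    intro j
    have := Finset.prod_ne_zero_iff.1 hprod (h j) (Finset.mem_univ _)
    rw [hh, sieveRow] at this
    by_contra hne
    exact this (if_neg hne)
  by_contra hne
  rcases hft : f t with _ | j
  · -- the part of `t` would contain `t`, `t'` and its `c i - 1` own rows
    have hpart : (Finset.univ.filter fun u : Factors m => cls u.1 = cls t.1).card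
        = c (cls t.1) := by
      rw [← hm (cls t.1), Finset.card_filter, Fintype.sum_sigma, Finset.sum_filter]
      exact Finset.sum_congr rfl fun x _ => by by_cases hx : cls x = cls t.1 <;> simp [hx]
    have hnot : ∀ {u}, f u = none → u ∉ (Finset.univ.filter fun j : Fin r =>
        own j = cls t.1).image h := by
      intro u hu hmem
      obtain ⟨j, _, hj⟩ := Finset.mem_image.1 hmem
      rw [← hj, hh] at hu
      exact absurd hu (by simp)
    have hsub : insert t (insert t' ((Finset.univ.filter fun j : Fin r =>
        own j = cls t.1).image h)) ⊆ Finset.univ.filter fun u : Factors m => cls u.1 = cls t.1 := by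
      intro u hu
      simp only [Finset.mem_insert, Finset.mem_image, Finset.mem_filter, Finset.mem_univ,
        true_and] at hu ⊢
      rcases hu with rfl | rfl | ⟨j, hj, rfl⟩
      · rfl
      · rw [hfst]
      · exact Fin.ext ((hrow j).symm.trans hj)
    have := Finset.card_le_card hsub
    rw [Finset.card_insert_of_notMem, Finset.card_insert_of_notMem (hnot (htt ▸ hft)),
      Finset.card_image_of_injective _ hinj, hpart] at this
    · have := hown (cls t.1)
      omega
    · rw [Finset.mem_insert, not_or]
      exact ⟨hne, hnot hft⟩
  · -- row `some j` would be used twice, so that fewer than `p` factors are left for the common row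
    obtain ⟨u, hu, huj⟩ : ∃ u, f u = some j ∧ u ≠ h j := by
      by_cases h1 : t = h j
      · exact ⟨t', htt ▸ hft, fun h2 => hne (h1.trans h2.symm)⟩
      · exact ⟨t, hft, h1⟩
    have hsub : insert u (Finset.univ.image h) ⊆
        Finset.univ.filter fun t : Factors m => ¬ f t = none := by
      intro v hv
      simp only [Finset.mem_insert, Finset.mem_image, Finset.mem_filter, Finset.mem_univ,
        true_and] at hv ⊢
      rcases hv with rfl | ⟨i, rfl⟩
      · simp [hu]
      · simp [hh]
    have h5 := Finset.card_le_card hsub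
    rw [Finset.card_insert_of_notMem, Finset.card_image_of_injective _ hinj, Finset.card_univ,
      Fintype.card_fin] at h5
    · have h3 := Finset.card_filter_add_card_filter_not
        (s := (Finset.univ : Finset (Factors m))) (fun t => f t = none)
      rw [Finset.card_univ, hcard] at h3
      omega
    · intro hmem
      obtain ⟨i, _, hi⟩ := Finset.mem_image.1 hmem
      have hij : i = j := by
        have := hh i
        rw [hi, hu] at this
        exact (Option.some_injective _ this).symm
      exact huj (by rw [← hi, hij])

/-- A monomial with a repeated variable is cancelled: exchanging the rows of two copies of the
variable is an involution without fixed points on the assignments that contribute. -/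
theorem sieveMonomial_eq_zero {F : Type*} [Field F] [CharP F 2] {n p : ℕ} {cls : Fin n → Fin p}
    {own : ℕ → ℕ} {r : ℕ} {g : ℕ → F} {c : Fin p → ℕ} {m : Fin n →₀ ℕ}
    (hown : ∀ i : Fin p, (Finset.univ.filter fun j : Fin r => own j = i).card + 1 = c i)
    (hm : ∀ i, ∑ x with cls x = i, m x = c i) (hmr : ∑ s, m s = r + p)
    {x : Fin n} (hx : 2 ≤ m x) : sieveMonomial cls own r g m = 0 := by
  classical
  let t : Factors m := ⟨x, ⟨0, by omega⟩⟩
  let t' : Factors m := ⟨x, ⟨1, by omega⟩⟩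
  have htt : t ≠ t' := by simp [t, t']
  have hval : ∀ f : Factors m → Option (Fin r),
      ∏ u, sieveRow cls own r g (f (Equiv.swap t t' u)) u.1
        = ∏ u, sieveRow cls own r g (f u) u.1 := by
    intro f
    rw [← Equiv.prod_comp (Equiv.swap t t') (fun u => sieveRow cls own r g (f u) u.1)]
    refine Finset.prod_congr rfl fun u _ => ?_
    congr 1
    by_cases h1 : u = t
    · subst h1; rw [Equiv.swap_apply_left]
    by_cases h2 : u = t'
    · subst h2; rw [Equiv.swap_apply_right]
    rw [Equiv.swap_apply_of_ne_of_ne h1 h2]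
  have hsieved : ∀ f : Factors m → Option (Fin r),
      Sieved p (f ∘ Equiv.swap t t') ↔ Sieved p f := by
    intro f
    refine and_congr ?_ (forall_congr' fun j => ?_)
    · rw [Finset.card_filter, Finset.card_filter,
        ← Equiv.sum_comp (Equiv.swap t t') (fun u => if f u = none then 1 else 0)]
      rfl
    · exact (Equiv.swap t t').exists_congr_left.trans (by simp)
  refine Finset.sum_involution (fun f _ => f ∘ Equiv.swap t t') ?_ ?_
    (fun _ _ => Finset.mem_univ _) ?_
  · intro f _
    simp only [hsieved, Function.comp_apply, hval]
    exact CharTwo.add_self_eq_zero _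
  · intro f _ hne heq
    have hs : Sieved p f := by
      by_contra h
      exact hne (if_neg h)
    rw [if_pos hs] at hne
    refine htt (hs.eq_of_fst_eq hown hm hmr hne rfl ?_)
    have := congrFun heq t
    rwa [Function.comp_apply, Equiv.swap_apply_left, eq_comm] at this
  · intro f _
    ext1 u
    simp

/-- A system of distinct rows for a multilinear monomial: in each part, one variable gets the
common row, and the others get the rows owned by the part, one each. -/
theorem exists_row_assignment {n p : ℕ} {cls : Fin n → Fin p} {own : ℕ → ℕ} {r : ℕ}
    {c : Fin p → ℕ} {m : Fin n →₀ ℕ}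
    (hown : ∀ i : Fin p, (Finset.univ.filter fun j : Fin r => own j = i).card + 1 = c i)
    (hlt : ∀ j : Fin r, own j < p) (hm : ∀ i, ∑ x with cls x = i, m x = c i)
    (hle : ∀ x, m x ≤ 1) :
    ∃ h : Fin n → Option (Fin r), (∀ x j, m x = 1 → h x = some j → own j = cls x) ∧
      Sieved p (fun t : Factors m => h t.1) := by
  classical
  have hcard : ∀ i : Fin p, Fintype.card {x : Fin n // m x = 1 ∧ cls x = i}
      = Fintype.card (Option {j : Fin r // own j = i}) := by
    intro i
    rw [Fintype.card_option, Fintype.card_subtype, Fintype.card_subtype, hown, ← hm i,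
      Finset.card_filter, Finset.sum_filter]
    refine Finset.sum_congr rfl fun x _ => ?_
    have := hle x
    by_cases h1 : m x = 1
    · by_cases h2 : cls x = i <;> simp [h1, h2]
    · by_cases h2 : cls x = i
      · simp [h1, h2]; omega
      · simp [h1, h2]
  have e : ∀ i : Fin p, {x : Fin n // m x = 1 ∧ cls x = i} ≃ Option {j : Fin r // own j = i} :=
    fun i => Fintype.equivOfCardEq (hcard i)
  let h : Fin n → Option (Fin r) := fun x =>
    if hx : m x = 1 then (e (cls x) ⟨x, hx, rfl⟩).map Subtype.val else none
  have hh : ∀ (i : Fin p) (y : {x : Fin n // m x = 1 ∧ cls x = i}),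
      h y = (e i y).map Subtype.val := by
    rintro i ⟨x, hx, rfl⟩
    simp [h, hx]
  have hone : ∀ t : Factors m, m t.1 = 1 := fun t => by
    have := hle t.1
    have := t.2.isLt
    omega
  refine ⟨h, ?_, ?_, ?_⟩
  · intro x j hx hj
    rw [hh (cls x) ⟨x, hx, rfl⟩, Option.map_eq_some_iff] at hj
    obtain ⟨⟨j', hj'⟩, _, rfl⟩ := hj
    exact hj'
  · have hp : (Finset.univ : Finset (Fin p)).card = p := by simp
    rw [← hp]
    refine Finset.card_bij (fun t _ => cls t.1) (fun _ _ => Finset.mem_univ _) ?_ ?_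
    · intro t ht t' ht' htt
      have ht : h t.1 = none := (Finset.mem_filter.1 ht).2
      have ht' : h t'.1 = none := (Finset.mem_filter.1 ht').2
      rw [hh _ ⟨t.1, hone t, rfl⟩, Option.map_eq_none_iff] at ht
      rw [hh (cls t.1) ⟨t'.1, hone t', htt.symm⟩, Option.map_eq_none_iff] at ht'
      have h1 := (e (cls t.1)).injective (ht.trans ht'.symm)
      have h2 : t.1 = t'.1 := congrArg Subtype.val h1
      obtain ⟨x, u⟩ := t
      obtain ⟨x', u'⟩ := t'
      obtain rfl : x = x' := h2
      congr 1
      ext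
      have := hle x
      have := u.isLt
      have := u'.isLt
      omega
    · intro i _
      have hy := ((e i).symm none).2
      refine ⟨⟨((e i).symm none).1, ⟨0, by omega⟩⟩, ?_, hy.2⟩
      simp [hh]
  · intro j
    let y := (e ⟨own j, hlt j⟩).symm (some ⟨j, rfl⟩)
    have hy := y.2
    refine ⟨⟨y.1, ⟨0, by omega⟩⟩, ?_⟩
    simp [hh, y]

/-- If a multilinear monomial appears in `P`, the sieve is not identically zero: with the rows of
a row assignment as unit vectors, that monomial alone survives. -/
theorem exists_sieveValue_ne_zero {F : Type*} [Field F] [CharP F 2] {n p : ℕ}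
    {cls : Fin n → Fin p} {own : ℕ → ℕ} {r : ℕ} {c : Fin p → ℕ}
    (hown : ∀ i : Fin p, (Finset.univ.filter fun j : Fin r => own j = i).card + 1 = c i)
    (hlt : ∀ j : Fin r, own j < p)
    (z : ℕ → F) (hz : Set.InjOn z (Finset.range (p + 1)))
    (P : MvPolynomial (Fin n) F) (hP : ∀ m ∈ P.support, ∑ s, m s = r + p)
    (hPc : ∀ m ∈ P.support, ∀ i, ∑ x with cls x = i, m x = c i)
    {m₀ : Fin n →₀ ℕ} (hm₀ : m₀ ∈ P.support) (hle : ∀ x, m₀ x ≤ 1) :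
    ∃ g : ℕ → F, sieveValue cls own r z P g ≠ 0 := by
  classical
  obtain ⟨h, hrow, hs⟩ := exists_row_assignment hown hlt (hPc m₀ hm₀) hle
  let num : Option (Fin r) → ℕ := fun o => o.elim r Fin.val
  have hnum : Function.Injective num := by
    rintro (_ | i) (_ | j) hij
    · rfl
    · exact absurd hij j.isLt.ne'
    · exact absurd hij i.isLt.ne
    · exact congrArg some (Fin.ext hij)
  let g : ℕ → F := fun t => if ∃ x : Fin n, m₀ x = 1 ∧ t = num (h x) * n + x then 1 else 0
  have hg : ∀ o (x : Fin n), g (num o * n + x) = if m₀ x = 1 ∧ h x = o then 1 else 0 := by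
    intro o x
    have : (∃ y : Fin n, m₀ y = 1 ∧ num o * n + x = num (h y) * n + y)
        ↔ (m₀ x = 1 ∧ h x = o) := by
      constructor
      · rintro ⟨y, hy, hxy⟩
        have hn : 0 < n := x.pos
        have h1 : (x : ℕ) = y := by
          have := congrArg (· % n) hxy
          simpa [Nat.add_comm _ (x : ℕ), Nat.add_comm _ (y : ℕ), Nat.mod_eq_of_lt] using this
        obtain rfl : x = y := Fin.ext h1
        have h2 : num o = num (h x) := Nat.eq_of_mul_eq_mul_right hn (Nat.add_right_cancel hxy)
        exact ⟨hy, (hnum h2).symm⟩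
      · rintro ⟨hx, rfl⟩
        exact ⟨x, hx, rfl⟩
    simp only [g, this]
  have hsr : ∀ o x, sieveRow cls own r g o x = if m₀ x = 1 ∧ h x = o then 1 else 0 := by
    rintro (_ | j) x
    · exact hg none x
    · rw [sieveRow]
      split_ifs with h1 h2 h2
      · exact (hg (some j) x).trans (if_pos h2)
      · exact (hg (some j) x).trans (if_neg h2)
      · exact absurd (hrow x j h2.1 h2.2) h1
      · rfl
  refine ⟨g, ?_⟩
  rw [sieveValue_eq_sum cls own r g z hz P hP, Finset.sum_eq_single_of_mem m₀ hm₀]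
  · refine mul_ne_zero (MvPolynomial.mem_support_iff.1 hm₀) ?_
    rw [sieveMonomial, Finset.sum_eq_single_of_mem (fun t => h t.1) (Finset.mem_univ _)]
    · rw [if_pos hs]
      refine Finset.prod_ne_zero_iff.2 fun t _ => ?_
      have h1 := hle t.1
      have h2 := t.2.isLt
      rw [hsr, if_pos ⟨by omega, rfl⟩]
      exact one_ne_zero
    · intro f _ hf
      split_ifs
      · obtain ⟨t, ht⟩ : ∃ t, f t ≠ h t.1 := by
          by_contra hcon
          push Not at hcon
          exact hf (funext hcon)
        refine Finset.prod_eq_zero (Finset.mem_univ t) ?_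
        rw [hsr, if_neg fun h => ht h.2.symm]
      · rfl
  · intro m hm hne
    by_cases h2 : ∃ x, 2 ≤ m x
    · obtain ⟨x, hx⟩ := h2
      rw [sieveMonomial_eq_zero hown (hPc m hm) (hP m hm) hx, mul_zero]
    · push Not at h2
      obtain ⟨x, hx⟩ : ∃ x, m₀ x < m x := by
        by_contra hcon
        push Not at hcon
        have := (Finset.sum_eq_sum_iff_of_le fun x (_ : x ∈ Finset.univ) => hcon x).1
          ((hP m hm).trans (hP m₀ hm₀).symm)
        exact hne (Finsupp.ext fun x => this x (Finset.mem_univ x))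
      refine mul_eq_zero_of_right _ (Finset.sum_eq_zero fun f _ => ?_)
      split_ifs
      · refine Finset.prod_eq_zero (Finset.mem_univ ⟨x, ⟨0, by omega⟩⟩) ?_
        rw [hsr, if_neg]
        rintro ⟨h3, _⟩
        have := h2 x
        change m₀ x = 1 at h3
        omega
      · rfl

/-- Without multilinear monomials, the sieve vanishes identically. -/
theorem sieveValue_eq_zero {F : Type*} [Field F] [CharP F 2] {n p : ℕ}
    {cls : Fin n → Fin p} {own : ℕ → ℕ} {r : ℕ} {c : Fin p → ℕ}
    (hown : ∀ i : Fin p, (Finset.univ.filter fun j : Fin r => own j = i).card + 1 = c i)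
    (z : ℕ → F) (hz : Set.InjOn z (Finset.range (p + 1)))
    (P : MvPolynomial (Fin n) F) (hP : ∀ m ∈ P.support, ∑ s, m s = r + p)
    (hPc : ∀ m ∈ P.support, ∀ i, ∑ x with cls x = i, m x = c i)
    (hno : ∀ m ∈ P.support, ∃ x, 2 ≤ m x) (g : ℕ → F) :
    sieveValue cls own r z P g = 0 := by
  rw [sieveValue_eq_sum cls own r g z hz P hP]
  refine Finset.sum_eq_zero fun m hm => ?_
  obtain ⟨x, hx⟩ := hno m hm
  rw [sieveMonomial_eq_zero hown (hPc m hm) (hP m hm) hx, mul_zero]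

/-! ### The probability that the sieve vanishes -/

theorem totalDegree_aeval_le {F : Type*} [CommRing F] {σ τ : Type*}
    (P : MvPolynomial σ F) (q : σ → MvPolynomial τ F) (hq : ∀ i, (q i).totalDegree ≤ 1) :
    (MvPolynomial.aeval q P).totalDegree ≤ P.totalDegree := by
  rw [MvPolynomial.aeval_def, MvPolynomial.eval₂_eq]
  refine MvPolynomial.totalDegree_finsetSum_le fun m hm => ?_
  refine (MvPolynomial.totalDegree_mul _ _).trans ?_
  rw [MvPolynomial.algebraMap_eq, MvPolynomial.totalDegree_C, zero_add]
  refine (MvPolynomial.totalDegree_finsetProd _ _).trans ?_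
  refine le_trans (Finset.sum_le_sum fun i _ => ?_) (MvPolynomial.le_totalDegree hm)
  refine (MvPolynomial.totalDegree_pow _ _).trans ?_
  simpa using Nat.mul_le_mul_left (m i) (hq i)

/-- The sequence `g` with the `L` entries from position `i` on replaced by those of `v`. -/
def overwrite {F : Type*} (g : ℕ → F) (i : ℕ) {L : ℕ} (v : Fin L → F) (t : ℕ) : F :=
  if h : i ≤ t ∧ t - i < L then v ⟨t - i, h.2⟩ else g t

/-- As a function of the matrix entries, the value of the sieve is a polynomial of degree at most
that of `P`. -/
theorem exists_sievePolynomial {F : Type*} [Field F] {n p : ℕ}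
    (cls : Fin n → Fin p) (own : ℕ → ℕ) (r : ℕ) (z : ℕ → F)
    (P : MvPolynomial (Fin n) F) (L : ℕ) (g : ℕ → F) :
    ∃ Q : MvPolynomial (Fin L) F, Q.totalDegree ≤ P.totalDegree ∧
      ∀ v : Fin L → F, MvPolynomial.eval v Q = sieveValue cls own r z P (overwrite g 0 v) := by
  let X : ℕ → MvPolynomial (Fin L) F := overwrite (fun t => MvPolynomial.C (g t)) 0 MvPolynomial.X
  have hX : ∀ t, (X t).totalDegree ≤ 1 := by
    intro t
    simp only [X, overwrite]
    split_ifs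
    · exact (MvPolynomial.totalDegree_X _).le
    · simp
  have hXe : ∀ v t, MvPolynomial.eval v (X t) = overwrite g 0 v t := by
    intro v t
    simp only [X, overwrite]
    split_ifs <;> simp
  let pt : F → ℕ → Fin n → MvPolynomial (Fin L) F := fun y m s =>
    MvPolynomial.C y * X (r * n + s)
      + ∑ j ∈ Finset.range r, if m / 2 ^ j % 2 = 1 ∧ own j = cls s then X (j * n + s) else 0
  have hpt : ∀ y m s, (pt y m s).totalDegree ≤ 1 := by
    intro y m s
    refine (MvPolynomial.totalDegree_add _ _).trans (max_le ?_ ?_)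
    · refine (MvPolynomial.totalDegree_mul _ _).trans ?_
      rw [MvPolynomial.totalDegree_C, zero_add]
      exact hX _
    · refine MvPolynomial.totalDegree_finsetSum_le fun j _ => ?_
      split_ifs
      · exact hX _
      · simp
  have hpte : ∀ v y m s, MvPolynomial.eval v (pt y m s)
      = sievePoint cls own r (overwrite g 0 v) y m s := by
    intro v y m s
    simp only [pt, sievePoint, map_add, map_mul, map_sum, MvPolynomial.eval_C, hXe]
    congr 1
    refine Finset.sum_congr rfl fun j _ => ?_
    split_ifs <;> simp [hXe]
  refine ⟨∑ k ∈ Finset.range (p + 1), ∑ m ∈ Finset.range (2 ^ r),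
    MvPolynomial.C (lagrangeWeight p z k) * MvPolynomial.aeval (pt (z k) m) P, ?_, ?_⟩
  · refine MvPolynomial.totalDegree_finsetSum_le fun k _ =>
      MvPolynomial.totalDegree_finsetSum_le fun m _ => ?_
    refine (MvPolynomial.totalDegree_mul _ _).trans ?_
    rw [MvPolynomial.totalDegree_C, zero_add]
    exact totalDegree_aeval_le P _ (hpt _ _)
  · intro v
    simp only [sieveValue, map_sum, map_mul, MvPolynomial.eval_C]
    refine Finset.sum_congr rfl fun k _ => Finset.sum_congr rfl fun m _ => ?_
    congr 1
    have : (MvPolynomial.eval v) (MvPolynomial.aeval (pt (z k) m) P)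
        = MvPolynomial.eval (fun s => MvPolynomial.eval v (pt (z k) m s)) P := by
      induction P using MvPolynomial.induction_on with
      | C a => simp
      | add P₁ P₂ h₁ h₂ => rw [map_add, map_add, h₁, h₂, map_add]
      | mul_X P₁ i h₁ =>
        rw [map_mul, map_mul, h₁, map_mul, MvPolynomial.aeval_X, MvPolynomial.eval_X]
    rw [this]
    simp_rw [hpte]

open Classical in
/-- By the Schwartz-Zippel lemma, a sieve that is not identically zero vanishes for at most a
fraction `d / |F|` of the matrices. -/
theorem card_sieveValue_eq_zero_le {F : Type*} [Field F] [Fintype F] {n p d : ℕ}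
    (cls : Fin n → Fin p) (own : ℕ → ℕ) (r : ℕ) (z : ℕ → F)
    (P : MvPolynomial (Fin n) F) (hP : P.totalDegree ≤ d) (g : ℕ → F)
    (hne : ∃ g : ℕ → F, sieveValue cls own r z P g ≠ 0) :
    (Finset.univ.filter fun v : Fin ((r + 1) * n) → F =>
        sieveValue cls own r z P (overwrite g 0 v) = 0).card * Fintype.card F
      ≤ d * Fintype.card F ^ ((r + 1) * n) := by
  obtain ⟨Q, hQdeg, hQ⟩ := exists_sievePolynomial cls own r z P ((r + 1) * n) g
  obtain ⟨g', hg'⟩ := hne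
  have hdep : ∀ g₁ g₂ : ℕ → F, (∀ t < (r + 1) * n, g₁ t = g₂ t) →
      sieveValue cls own r z P g₁ = sieveValue cls own r z P g₂ := by
    intro g₁ g₂ h12
    have hlt : ∀ j ≤ r, ∀ s : Fin n, j * n + s < (r + 1) * n := fun j hj s => by
      have := s.isLt
      have := Nat.mul_le_mul_right n hj
      rw [Nat.succ_mul]
      omega
    have : sievePoint cls own r g₁ = sievePoint cls own r g₂ := by
      funext y m s
      rw [sievePoint, sievePoint, h12 _ (hlt r le_rfl s)]
      congr 1
      refine Finset.sum_congr rfl fun j hj => ?_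
      rw [h12 _ (hlt j (Finset.mem_range.1 hj).le s)]
    rw [sieveValue, sieveValue, this]
  have hQ0 : Q ≠ 0 := by
    rintro rfl
    refine hg' ?_
    have := hQ fun t => g' t
    rw [map_zero] at this
    rw [this]
    refine hdep _ _ fun t ht => ?_
    simp [overwrite, ht]
  have hSZ := MvPolynomial.schwartz_zippel_totalDegree hQ0 (Finset.univ : Finset F)
  have hq : (0 : ℚ≥0) < Fintype.card F := by exact_mod_cast Fintype.card_pos
  rw [Finset.card_univ, div_le_div_iff₀ (by positivity) hq] at hSZ
  simp only [Fintype.piFinset_univ, hQ] at hSZ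
  have h3 : (Q.totalDegree : ℚ≥0) * Fintype.card F ^ ((r + 1) * n)
      ≤ d * Fintype.card F ^ ((r + 1) * n) := by
    gcongr
    exact hQdeg.trans hP
  exact_mod_cast hSZ.trans h3

/-! ### Bounds on the space in use -/

/-- All nonzero cells lie in the first `32` arrays, at positions below `ℓ`, and hold values
below `V`. -/
def Memory.Bounded (ℓ V : ℕ) (M : Memory) : Prop :=
  ∀ a i, M (a, i) ≠ 0 → a < 32 ∧ i < ℓ ∧ M (a, i) < V

/-- A bound for the number of bits of a bounded memory. -/
def memoryCap (ℓ V : ℕ) : ℕ := 32 * ℓ * (6 + ℓ.size + V.size)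

theorem Memory.Bounded.bits_le {ℓ V : ℕ} {M : Memory} (hM : M.Bounded ℓ V) :
    M.bits ≤ memoryCap ℓ V := by
  have hsub : M.support ⊆ Finset.range 32 ×ˢ Finset.range ℓ := by
    rintro ⟨a, i⟩ hai
    have := hM a i (Finsupp.mem_support_iff.1 hai)
    simp [this.1, this.2.1]
  have hcard := Finset.card_le_card hsub
  rw [Finset.card_product, Finset.card_range, Finset.card_range] at hcard
  refine (Finset.sum_le_card_nsmul _ _ (6 + ℓ.size + V.size) ?_).trans ?_
  · rintro ⟨a, i⟩ hai
    obtain ⟨h1, h2, h3⟩ := hM a i (Finsupp.mem_support_iff.1 hai)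
    have h1' : a.size ≤ 5 := Nat.size_le.2 h1
    have h2' := Nat.size_le_size h2.le
    have h3' := Nat.size_le_size h3.le
    dsimp only
    omega
  · rw [smul_eq_mul]
    exact Nat.mul_le_mul_right _ hcard

theorem Memory.Bounded.lt {ℓ V : ℕ} {M : Memory} (hM : M.Bounded ℓ V) (hV : 0 < V)
    (x : ℕ × ℕ) : M x < V := by
  by_cases h : M x = 0
  · omega
  · exact (hM x.1 x.2 h).2.2

theorem Memory.update_apply (M : Memory) (x y : ℕ × ℕ) (v : ℕ) :
    (M.update x v) y = if y = x then v else M y := by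
  rw [Finsupp.coe_update, Function.update_apply]

theorem Memory.Bounded.update {ℓ V : ℕ} {M : Memory} (hM : M.Bounded ℓ V) {a i v : ℕ}
    (ha : a < 32) (hi : i < ℓ) (hv : v < V) : Memory.Bounded ℓ V (M.update (a, i) v) := by
  intro a' i' h
  rw [Memory.update_apply] at h ⊢
  split_ifs at h ⊢ with heq
  · obtain ⟨rfl, rfl⟩ := Prod.mk.inj heq
    exact ⟨ha, hi, hv⟩
  · exact hM a' i' h

theorem Oracle.enc_lt {F : Type*} [Field F] [Fintype F] {n : ℕ} (O : Oracle F n) (x : F) :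
    O.enc x < Fintype.card F := (O.code x).isLt

@[simp] theorem Oracle.dec_enc {F : Type*} [Field F] [Fintype F] {n : ℕ} (O : Oracle F n)
    (x : F) : O.dec (O.enc x) = x := by
  rw [Oracle.dec, dif_pos (O.enc_lt x)]
  simp [Oracle.enc]

/-- A syntactic measure of an expression that controls the bits needed for its evaluation. -/
def Expr.weight : Expr → ℕ
  | const k => k.size + 1
  | get _ e => e.weight + 1
  | add e f => e.weight + f.weight + 1
  | sub e f => e.weight + f.weight + 1
  | mul e f => e.weight + f.weight + 1
  | div e f => e.weight + f.weight + 1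
  | fzero => 1
  | fone => 1
  | fadd e f => e.weight + f.weight + 1
  | fmul e f => e.weight + f.weight + 1
  | finv e => e.weight + 1
  | peval _ => 1

theorem size_mul_le (x y : ℕ) : (x * y).size ≤ x.size + y.size := by
  rw [Nat.size_le, pow_add]
  exact Nat.mul_lt_mul'' (Nat.lt_size_self x) (Nat.lt_size_self y)

theorem size_add_le (x y : ℕ) : (x + y).size ≤ x.size + y.size + 1 := by
  have hx := Nat.lt_size_self x
  have hy := Nat.lt_size_self y
  have h1 := Nat.pow_le_pow_right (n := 2) (by norm_num) (Nat.le_add_right x.size y.size)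
  have h2 := Nat.pow_le_pow_right (n := 2) (by norm_num) (Nat.le_add_left y.size x.size)
  rw [Nat.size_le, pow_succ]
  omega

section Expressions

variable {F : Type*} [Field F] [Fintype F] {n : ℕ}

theorem Expr.size_eval_le (O : Oracle F n) {V : ℕ} (hV : Fintype.card F ≤ V) (M : Memory)
    (hM : ∀ x, M x < V) (e : Expr) : (e.eval O M).size ≤ e.weight * (V.size + 1) := by
  have hle : ∀ {x}, x < V → x.size ≤ V.size + 1 := fun h =>
    (Nat.size_le_size h.le).trans (Nat.le_succ _)
  have henc : ∀ (x : F) (w : ℕ), (O.enc x).size ≤ (w + 1) * (V.size + 1) := fun x w =>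
    (hle ((O.enc_lt x).trans_le hV)).trans (Nat.le_mul_of_pos_left _ (Nat.succ_pos _))
  induction e with
  | const k => simp only [eval, weight]; nlinarith
  | get a e _ =>
    exact (hle (hM _)).trans (Nat.le_mul_of_pos_left _ (Nat.succ_pos _))
  | add e f he hf =>
    have := size_add_le (e.eval O M) (f.eval O M)
    simp only [eval, weight]; nlinarith
  | sub e f he hf =>
    have := Nat.size_le_size (Nat.sub_le (e.eval O M) (f.eval O M))
    simp only [eval, weight]; nlinarith
  | mul e f he hf =>
    have := size_mul_le (e.eval O M) (f.eval O M)
    simp only [eval, weight]; nlinarith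
  | div e f he hf =>
    have := Nat.size_le_size (Nat.div_le_self (e.eval O M) (f.eval O M))
    simp only [eval, weight]; nlinarith
  | fzero => exact henc _ 0
  | fone => exact henc _ 0
  | fadd e f _ _ => exact henc _ _
  | fmul e f _ _ => exact henc _ _
  | finv e _ => exact henc _ _
  | peval a => exact henc _ 0

theorem Expr.bits_le (O : Oracle F n) {V : ℕ} (hV : Fintype.card F ≤ V) (M : Memory)
    (hM : ∀ x, M x < V) (e : Expr) : e.bits O M ≤ e.weight ^ 2 * (V.size + 1) := by
  have hs := Expr.size_eval_le O hV M hM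
  have key : ∀ (w w' B x y t : ℕ), x ≤ w ^ 2 * B → y ≤ w' ^ 2 * B → t ≤ (w + w' + 1) * B →
      x + y + t ≤ (w + w' + 1) ^ 2 * B := by
    intro w w' B x y t hx hy ht
    have : w ^ 2 + w' ^ 2 + (w + w' + 1) ≤ (w + w' + 1) ^ 2 := by nlinarith
    nlinarith [Nat.mul_le_mul_right B this]
  have key1 : ∀ (w B x t : ℕ), x ≤ w ^ 2 * B → t ≤ (w + 1) * B → x + t ≤ (w + 1) ^ 2 * B := by
    intro w B x t hx ht
    have : w ^ 2 + (w + 1) ≤ (w + 1) ^ 2 := by nlinarith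
    nlinarith [Nat.mul_le_mul_right B this]
  induction e with
  | const k =>
    have := hs (const k)
    simp only [eval, bits, weight] at this ⊢
    nlinarith
  | get a e he => exact key1 _ _ _ _ he (hs (get a e))
  | add e f he hf => exact key _ _ _ _ _ _ he hf (hs (add e f))
  | sub e f he hf => exact key _ _ _ _ _ _ he hf (hs (sub e f))
  | mul e f he hf => exact key _ _ _ _ _ _ he hf (hs (mul e f))
  | div e f he hf => exact key _ _ _ _ _ _ he hf (hs (div e f))
  | fzero => simpa [bits, weight] using hs fzero
  | fone => simpa [bits, weight] using hs fone
  | fadd e f he hf => exact key _ _ _ _ _ _ he hf (hs (fadd e f))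
  | fmul e f he hf => exact key _ _ _ _ _ _ he hf (hs (fmul e f))
  | finv e he => exact key1 _ _ _ _ he (hs (finv e))
  | peval a => simpa [bits, weight] using hs (peval a)

end Expressions

/-! ### A program logic for correctness, time and space -/

namespace Program

/-- A syntactic measure of a program that controls the bits needed besides the memory. -/
def weight : Program → ℕ
  | skip => 0
  | set _ e f => e.weight ^ 2 + f.weight ^ 2
  | rand _ e => e.weight ^ 2
  | seq c₁ c₂ => c₁.weight + c₂.weight
  | ite e c₁ c₂ => e.weight ^ 2 + c₁.weight + c₂.weight
  | loop e c => e.weight ^ 2 + e.weight + c.weight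

/-- The arrays to which a program may write. -/
def writes : Program → List ℕ
  | skip => []
  | set a _ _ => [a]
  | rand a _ => [a]
  | seq c₁ c₂ => c₁.writes ++ c₂.writes
  | ite _ c₁ c₂ => c₁.writes ++ c₂.writes
  | loop _ c => c.writes

variable {F : Type*} [Field F] [Fintype F] {n : ℕ}

/-- Started in the memory `M`, if it is bounded, the program makes at most `T` steps, uses no more
space than its weight allows, and ends in a bounded memory that satisfies `Q`, whatever the random
choices are. -/
def Ensures (O : Oracle F n) (ℓ V : ℕ) (c : Program) (T : ℕ) (M : Memory)
    (Q : Memory → Prop) : Prop :=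
  ∀ b s, s.mem = M → M.Bounded ℓ V → ∀ s' ∈ (c.run O b s).support,
    Q s'.mem ∧ s'.mem.Bounded ℓ V ∧ s'.time ≤ s.time + T ∧
      s'.space ≤ max s.space (b + memoryCap ℓ V + c.weight * (V.size + 1))

theorem mem_of_repeatRun {f : RunState → PMF RunState} {Inv : ℕ → RunState → Prop} {k i : ℕ}
    {s s' : RunState} (hs : Inv i s)
    (hstep : ∀ j t, j < i + k → Inv j t → ∀ t' ∈ (f (t.charge 1 0)).support, Inv (j + 1) t')
    (h : s' ∈ (RunState.repeatRun f k s).support) : Inv (i + k) s' := by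
  induction k generalizing i s with
  | zero =>
    rw [RunState.repeatRun, PMF.support_pure, Set.mem_singleton_iff] at h
    exact h ▸ hs
  | succ k ih =>
    rw [RunState.repeatRun, PMF.mem_support_bind_iff] at h
    obtain ⟨t, ht, h⟩ := h
    have h1 := hstep i s (by omega) hs t ht
    have := ih h1 (fun j t hj => hstep j t (by omega)) h
    rwa [show i + (k + 1) = i + 1 + k by omega]

theorem mem_eq_of_notMem_writes (O : Oracle F n) (c : Program) {a : ℕ} (ha : a ∉ c.writes)
    (i b : ℕ) (s s' : RunState) (h : s' ∈ (c.run O b s).support) :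
    s'.mem (a, i) = s.mem (a, i) := by
  induction c generalizing b s s' with
  | skip =>
    rw [run, PMF.support_pure, Set.mem_singleton_iff] at h
    rw [h]; rfl
  | set a' e f =>
    rw [run, PMF.support_pure, Set.mem_singleton_iff] at h
    rw [writes, List.mem_singleton] at ha
    rw [h]
    simp [RunState.write, RunState.charge, ha]
  | rand a' e =>
    rw [run, PMF.mem_support_bind_iff] at h
    obtain ⟨x, _, h⟩ := h
    rw [PMF.support_pure, Set.mem_singleton_iff] at h
    rw [writes, List.mem_singleton] at ha
    rw [h]
    simp [RunState.write, RunState.charge, ha]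
  | seq c₁ c₂ h₁ h₂ =>
    rw [run, PMF.mem_support_bind_iff] at h
    obtain ⟨t, ht, h⟩ := h
    rw [writes, List.mem_append, not_or] at ha
    rw [h₂ ha.2 _ _ _ h, h₁ ha.1 _ _ _ ht]
  | ite e c₁ c₂ h₁ h₂ =>
    rw [writes, List.mem_append, not_or] at ha
    rw [run] at h
    split_ifs at h
    · exact h₁ ha.1 b (s.charge (e.cost + 1) (b + e.bits O s.mem)) s' h
    · exact h₂ ha.2 b (s.charge (e.cost + 1) (b + e.bits O s.mem)) s' h
  | loop e c hc =>
    rw [run] at h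
    refine mem_of_repeatRun (Inv := fun _ t => t.mem (a, i) = s.mem (a, i)) (i := 0)
      (s := s.charge (e.cost + 1) (b + e.bits O s.mem)) rfl ?_ h
    intro _ t _ ht t' ht'
    exact (hc ha _ _ _ ht').trans ht

section Rules

variable {O : Oracle F n} {ℓ V : ℕ}

theorem Ensures.mono {c : Program} {T T' : ℕ} {M : Memory} {Q Q' : Memory → Prop}
    (h : Ensures O ℓ V c T M Q) (hT : T ≤ T') (hQ : ∀ M', M'.Bounded ℓ V → Q M' → Q' M') :
    Ensures O ℓ V c T' M Q' := by
  intro b s hs hM s' hs'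
  obtain ⟨h1, h2, h3, h4⟩ := h b s hs hM s' hs'
  exact ⟨hQ _ h2 h1, h2, h3.trans (Nat.add_le_add_left hT _), h4⟩

theorem Ensures.of_bounded {c : Program} {T : ℕ} {M : Memory} {Q : Memory → Prop}
    (h : M.Bounded ℓ V → Ensures O ℓ V c T M Q) : Ensures O ℓ V c T M Q :=
  fun b s hs hM => h hM b s hs hM

theorem Ensures.frame {c : Program} {T : ℕ} {M : Memory} {Q : Memory → Prop}
    (h : Ensures O ℓ V c T M Q) :
    Ensures O ℓ V c T M fun M' => Q M' ∧ ∀ a ∉ c.writes, ∀ i, M' (a, i) = M (a, i) := by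
  intro b s hs hM s' hs'
  obtain ⟨h1, h2⟩ := h b s hs hM s' hs'
  exact ⟨⟨h1, fun a ha i => hs ▸ mem_eq_of_notMem_writes O c ha i b s s' hs'⟩, h2⟩

theorem ensures_skip {M : Memory} {Q : Memory → Prop} (h : Q M) : Ensures O ℓ V skip 1 M Q := by
  intro b s hs hM s' hs'
  rw [run, PMF.support_pure, Set.mem_singleton_iff] at hs'
  subst hs' hs
  have := hM.bits_le
  refine ⟨h, hM, le_rfl, ?_⟩
  simp only [RunState.charge, weight]
  omega

theorem ensures_set (hV : Fintype.card F ≤ V) {a : ℕ} {e f : Expr} {M : Memory}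
    {Q : Memory → Prop} (ha : a < 32) (he : e.eval O M < ℓ) (hf : f.eval O M < V)
    (h : Q (M.update (a, e.eval O M) (f.eval O M))) :
    Ensures O ℓ V (set a e f) (e.cost + f.cost + 1) M Q := by
  intro b s hs hM s' hs'
  rw [run, PMF.support_pure, Set.mem_singleton_iff] at hs'
  subst hs' hs
  have hM' := hM.update ha he hf
  have hlt := hM.lt (by omega)
  have := hM.bits_le
  have := hM'.bits_le
  have := e.bits_le O hV s.mem hlt
  have := f.bits_le O hV s.mem hlt
  refine ⟨h, hM', le_rfl, ?_⟩
  simp only [RunState.charge, RunState.write, weight, add_mul]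
  omega

theorem ensures_rand (hV : Fintype.card F ≤ V) {a : ℕ} {e : Expr} {M : Memory}
    {Q : Memory → Prop} (ha : a < 32) (he : e.eval O M < ℓ)
    (h : ∀ x, Q (M.update (a, e.eval O M) (O.enc x))) :
    Ensures O ℓ V (rand a e) (e.cost + 1) M Q := by
  intro b s hs hM s' hs'
  rw [run, PMF.mem_support_bind_iff] at hs'
  obtain ⟨x, _, hs'⟩ := hs'
  rw [PMF.support_pure, Set.mem_singleton_iff] at hs'
  subst hs' hs
  have hM' := hM.update ha he ((O.enc_lt x).trans_le hV)
  have hlt := hM.lt ((Nat.zero_le _).trans_lt ((O.enc_lt x).trans_le hV))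
  have := hM.bits_le
  have := hM'.bits_le
  have := e.bits_le O hV s.mem hlt
  refine ⟨h x, hM', le_rfl, ?_⟩
  simp only [RunState.charge, RunState.write, weight]
  omega

theorem ensures_seq {c₁ c₂ : Program} {T₁ T₂ : ℕ} {M : Memory} {Q : Memory → Prop}
    (h : Ensures O ℓ V c₁ T₁ M fun M' => Ensures O ℓ V c₂ T₂ M' Q) :
    Ensures O ℓ V (seq c₁ c₂) (T₁ + T₂) M Q := by
  intro b s hs hM s' hs'
  rw [run, PMF.mem_support_bind_iff] at hs'
  obtain ⟨t, ht, hs'⟩ := hs'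
  obtain ⟨h1, h2, h3, h4⟩ := h b s hs hM t ht
  obtain ⟨h5, h6, h7, h8⟩ := h1 b t rfl h2 s' hs'
  refine ⟨h5, h6, by omega, ?_⟩
  simp only [weight, add_mul]
  omega

theorem ensures_ite (hV : Fintype.card F ≤ V) {e : Expr} {c₁ c₂ : Program} {T : ℕ} {M : Memory}
    {Q : Memory → Prop} (h₁ : e.eval O M ≠ 0 → Ensures O ℓ V c₁ T M Q)
    (h₂ : e.eval O M = 0 → Ensures O ℓ V c₂ T M Q) :
    Ensures O ℓ V (ite e c₁ c₂) (e.cost + 1 + T) M Q := by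
  intro b s hs hM s' hs'
  subst hs
  have hlt := hM.lt (Fintype.card_pos.trans_le hV)
  have h9 := hM.bits_le
  have h10 := e.bits_le O hV s.mem hlt
  rw [run] at hs'
  split_ifs at hs' with h
  · obtain ⟨h1, h2, h3, h4⟩ :=
      h₁ h b (s.charge (e.cost + 1) (b + e.bits O s.mem)) rfl hM s' hs'
    refine ⟨h1, h2, ?_, ?_⟩
    · simp only [RunState.charge] at h3; omega
    · simp only [weight, add_mul, RunState.charge] at h4 ⊢; omega
  · obtain ⟨h1, h2, h3, h4⟩ :=
      h₂ (not_not.1 h) b (s.charge (e.cost + 1) (b + e.bits O s.mem)) rfl hM s' hs'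
    refine ⟨h1, h2, ?_, ?_⟩
    · simp only [RunState.charge] at h3; omega
    · simp only [weight, add_mul, RunState.charge] at h4 ⊢; omega

theorem ensures_loop (hV : Fintype.card F ≤ V) {e : Expr} {c : Program} {K T : ℕ} {M : Memory}
    {Q : Memory → Prop} (Inv : ℕ → Memory → Prop) (he : e.eval O M = K) (h0 : Inv 0 M)
    (hstep : ∀ i < K, ∀ M', Inv i M' → Ensures O ℓ V c T M' (Inv (i + 1)))
    (hQ : ∀ M', Inv K M' → Q M') :
    Ensures O ℓ V (loop e c) (e.cost + 1 + K * (T + 1)) M Q := by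
  intro b s hs hM s' hs'
  subst hs
  have hlt := hM.lt (Fintype.card_pos.trans_le hV)
  have h9 := hM.bits_le
  have h10 := e.bits_le O hV s.mem hlt
  have h11 := e.size_eval_le O hV s.mem hlt
  rw [run, he] at hs'
  rw [he] at h11
  have := mem_of_repeatRun (i := 0) (s := s.charge (e.cost + 1) (b + e.bits O s.mem))
    (Inv := fun i t => Inv i t.mem ∧ t.mem.Bounded ℓ V ∧
    t.time ≤ s.time + e.cost + 1 + i * (T + 1) ∧ t.space ≤ max s.space
      (b + memoryCap ℓ V + (loop e c).weight * (V.size + 1))) ⟨h0, hM, ?_, ?_⟩ ?_ hs'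
  · obtain ⟨h1, h2, h3, h4⟩ := this
    rw [zero_add] at h1 h3
    exact ⟨hQ _ h1, h2, by omega, h4⟩
  · simp only [RunState.charge]; omega
  · simp only [weight, add_mul, RunState.charge]; omega
  · intro j t hj ht t' ht'
    obtain ⟨h1, h2, h3, h4⟩ := ht
    obtain ⟨h5, h6, h7, h8⟩ := hstep j (by omega) t.mem h1 _ (t.charge 1 0) rfl h2 t' ht'
    have := h2.bits_le
    refine ⟨h5, h6, ?_, ?_⟩
    · simp only [RunState.charge] at h7; rw [add_mul, one_mul]; omega
    · simp only [weight, add_mul, RunState.charge] at h4 h8 ⊢; omega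

end Rules

/-- `for v = 0, …, e - 1 do c`, with the counter in entry `0` of array `v`. -/
def forLoop (v : ℕ) (e : Expr) (c : Program) : Program :=
  seq (set v (.const 0) (.const 0)) (loop e (seq c
    (set v (.const 0) (.add (.get v (.const 0)) (.const 1)))))

/-- The rule for counting loops. The invariant may rely on the arrays outside of
`(forLoop v e c).writes` being unchanged. -/
theorem ensures_forLoop {O : Oracle F n} {ℓ V : ℕ} (hV : Fintype.card F ≤ V) {v : ℕ} {e : Expr}
    {c : Program} {K T : ℕ} {M : Memory} {Q : Memory → Prop} (Inv : ℕ → Memory → Prop)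
    (hv : v < 32) (hℓ : 0 < ℓ) (hK : K < V) (hvc : v ∉ c.writes)
    (he : e.eval O (M.update (v, 0) 0) = K) (h0 : Inv 0 (M.update (v, 0) 0))
    (hstep : ∀ i < K, ∀ M' : Memory, M' (v, 0) = i →
      (∀ a ∉ v :: c.writes, ∀ j, M' (a, j) = M (a, j)) → Inv i M' →
      Ensures O ℓ V c T M' fun M'' => Inv (i + 1) (M''.update (v, 0) (i + 1)))
    (hQ : ∀ M' : Memory, (∀ a ∉ v :: c.writes, ∀ j, M' (a, j) = M (a, j)) → Inv K M' → Q M') :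
    Ensures O ℓ V (forLoop v e c) (e.cost + 4 + K * (T + 7)) M Q := by
  have h1 : Ensures O ℓ V (forLoop v e c) (3 + (e.cost + 1 + K * (T + 6 + 1))) M Q := by
    refine ensures_seq (ensures_set (e := .const 0) (f := .const 0) hV hv hℓ
      (Nat.zero_lt_of_lt hK) ?_)
    refine ensures_loop hV (fun i M' => M' (v, 0) = i ∧
      (∀ a ∉ v :: c.writes, ∀ j, M' (a, j) = M (a, j)) ∧ Inv i M') he ⟨?_, ?_, h0⟩ ?_ ?_
    · simp [Memory.update_apply, Expr.eval]
    · intro a ha j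
      rw [List.mem_cons, not_or] at ha
      simp [ha.1]
    · rintro i hi M' ⟨h1, h2, h3⟩
      refine ensures_seq ((hstep i hi M' h1 h2 h3).frame.mono le_rfl ?_)
      rintro M'' _ ⟨h4, h5⟩
      have h6 : M'' (v, 0) = i := (h5 v hvc 0).trans h1
      have h7 : (Expr.add (.get v (.const 0)) (.const 1)).eval O M'' = i + 1 := by
        simp [Expr.eval, h6]
      refine (ensures_set hV hv hℓ (by rw [h7]; omega) ?_)
      rw [h7]
      refine ⟨by simp [Expr.eval], fun a ha j => ?_, h4⟩
      have ha' := ha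
      rw [List.mem_cons, not_or] at ha'
      rw [Memory.update_apply, if_neg (by simp [ha'.1]), h5 a ha'.2, h2 a ha]
    · rintro M' ⟨_, h2, h3⟩
      exact hQ M' h2 h3
  refine h1.mono ?_ fun _ _ h => h
  rw [show T + 6 + 1 = T + 7 from rfl]
  omega

end Program

/-! ### Evaluation of the sieve -/

/-! Arrays `0`, `1`, `2` hold the input and array `3` the flag. Array `4` holds the random matrix,
row by row; array `5` the owners of the rows; entry `0` of arrays `6` and `7` the number `r` of
rows and `2 ^ r`. Arrays `8` to `17` and `19` are used for scalars, and array `18` for the point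
at which the polynomial is evaluated. -/

namespace Program

/-- Entry `0` of an array, used as a variable. -/
abbrev rd (a : ℕ) : Expr := .get a (.const 0)

/-- A test for inequality of two numbers. -/
abbrev neq (e f : Expr) : Expr := .add (.sub e f) (.sub f e)

/-- Array `15` holds `m` shifted by the number of rows seen so far, so that its lowest bit tells
whether the present row takes part; a row counts only if it is owned by the part of the
variable. -/
def rowTest : Expr :=
  .mul (.sub (rd 15) (.mul (.const 2) (.div (rd 15) (.const 2))))
    (.sub (.const 1) (neq (.get 5 (rd 17)) (.get 2 (rd 14))))

/-- Computes one coordinate of the evaluation point: `k`, `m` and the number of the variable are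
in arrays `12`, `13`, `14`, and the result is written to array `18`. -/
def computeEntry : Program :=
  seq (set 15 (.const 0) (rd 13)) <|
  seq (set 16 (.const 0)
    (.fmul (rd 12) (.get 4 (.add (.mul (rd 6) (rd 0)) (rd 14))))) <|
  seq (forLoop 17 (rd 6) <|
    seq (ite rowTest
      (set 16 (.const 0) (.fadd (rd 16) (.get 4 (.add (.mul (rd 17) (rd 0)) (rd 14))))) skip)
    (set 15 (.const 0) (.div (rd 15) (.const 2)))) <|
  set 18 (rd 14) (rd 16)

/-- Computes the evaluation point for given `k` and `m`. -/
def computePoint : Program := forLoop 14 (rd 0) computeEntry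

/-- Computes the Lagrange weight of the node with number `k` into array `11`. The nodes are the
field elements with the numbers `0, …, p`, so that the loop counters serve as field elements. -/
def computeWeight : Program :=
  seq (set 11 (.const 0) .fone) <|
  forLoop 19 (.add (.get 0 (.const 1)) (.const 1)) <|
    ite (neq (rd 12) (rd 19))
      (set 11 (.const 0) (.fmul (rd 11) (.finv (.fadd (rd 12) (rd 19))))) skip

/-- Adds the weighted values of the polynomial for all `m` to array `10`. -/
def accumulate : Program :=
  forLoop 13 (rd 7) <|
    seq computePoint (set 10 (.const 0) (.fadd (rd 10) (.fmul (rd 11) (.peval 18))))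

/-- Computes the value of the sieve into array `10`. -/
def computeSieve : Program :=
  seq (set 10 (.const 0) .fzero) <|
  forLoop 12 (.add (.get 0 (.const 1)) (.const 1)) (seq computeWeight accumulate)

/-- Raises the flag if the value of the sieve is nonzero. -/
def raiseFlag : Program := ite (neq (rd 10) .fzero) (set 3 (.const 0) (.const 1)) skip

/-- Fills the matrix of array `4` with random field elements. -/
def draw : Program := forLoop 8 (.mul (.add (rd 6) (.const 1)) (rd 0)) (rand 4 (rd 8))

/-- One round: evaluate the sieve for a random matrix. -/
def round : Program := seq draw (seq computeSieve raiseFlag)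

end Program

/-- The memory describes an input with `n` variables and `p` parts, an ownership of `r` rows, and
the number `2 ^ r`. -/
structure Prepared {n p : ℕ} (cls : Fin n → Fin p) (own : ℕ → ℕ) (r : ℕ) (M : Memory) : Prop where
  numVars : M (0, 0) = n
  numParts : M (0, 1) = p
  part : ∀ x : Fin n, M (2, (x : ℕ)) = cls x
  owner : ∀ j < r, M (5, j) = own j
  numRows : M (6, 0) = r
  pow : M (7, 0) = 2 ^ r

theorem Prepared.congr {n p : ℕ} {cls : Fin n → Fin p} {own : ℕ → ℕ} {r : ℕ} {M M' : Memory}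
    (h : Prepared cls own r M) (hM : ∀ a, a = 0 ∨ a = 2 ∨ a = 5 ∨ a = 6 ∨ a = 7 →
      ∀ j, M' (a, j) = M (a, j)) : Prepared cls own r M' where
  numVars := by rw [hM _ (by simp), h.numVars]
  numParts := by rw [hM _ (by simp), h.numParts]
  part x := by rw [hM _ (by simp), h.part]
  owner j hj := by rw [hM _ (by simp), h.owner j hj]
  numRows := by rw [hM _ (by simp), h.numRows]
  pow := by rw [hM _ (by simp), h.pow]

/-- The bounds on addresses and values that the algorithm respects. -/
structure Capacity (F : Type*) [Fintype F] (n ℓ V : ℕ) : Prop where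
  field : Fintype.card F ≤ V
  address : (n + 1) * (n + 1) < ℓ
  sq : (n + 1) * (n + 1) < V
  pow : 2 ^ n < V

/-- The matrix that array `4` holds. -/
noncomputable def Oracle.matrix {F : Type*} [Field F] [Fintype F] {n : ℕ} (O : Oracle F n)
    (M : Memory) (t : ℕ) : F := O.dec (M (4, t))

namespace Program

variable {F : Type*} [Field F] [Fintype F] {n p : ℕ} {O : Oracle F n} {ℓ V : ℕ}
  {cls : Fin n → Fin p} {own : ℕ → ℕ} {r : ℕ}

theorem eval_neq_ne_zero {e f : Expr} {M : Memory} :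
    (neq e f).eval O M ≠ 0 ↔ e.eval O M ≠ f.eval O M := by
  simp only [Expr.eval]
  omega

theorem eval_rowTest_ne_zero {M : Memory} :
    rowTest.eval O M ≠ 0 ↔ M (15, 0) % 2 = 1 ∧ M (5, M (17, 0)) = M (2, M (14, 0)) := by
  rw [rowTest, Expr.eval, mul_ne_zero_iff]
  simp only [Expr.eval]
  omega

theorem ensures_computeEntry (hC : Capacity F n ℓ V) {M : Memory} (hM : Prepared cls own r M)
    (hr : r ≤ n) {s : Fin n} (hs : M (14, 0) = s) :
    Ensures O ℓ V computeEntry (100 * (n + 1)) M fun M' =>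
      O.dec (M' (18, (s : ℕ)))
        = sievePoint cls own r (O.matrix M) (O.dec (M (12, 0))) (M (13, 0)) s ∧
      ∀ t, t ≠ (s : ℕ) → M' (18, t) = M (18, t) := by
  have hV := hC.field
  have hsq := hC.sq
  have had := hC.address
  have hsn := s.isLt
  have henc : ∀ x, O.enc x < V := fun x => (O.enc_lt x).trans_le hV
  have hℓ : 0 < ℓ := by omega
  have hrV : r < V := by nlinarith
  refine Ensures.of_bounded fun hMb => ?_
  apply Ensures.mono (Q := fun M' =>
      M' (18, (s : ℕ)) = O.enc (sievePoint cls own r (O.matrix M) (O.dec (M (12, 0)))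
        (M (13, 0)) s) ∧ ∀ t, t ≠ (s : ℕ) → M' (18, t) = M (18, t))
  case h =>
    apply ensures_seq
    refine ensures_set hV (by norm_num) hℓ (hMb.lt (by omega) _) ?_
    apply ensures_seq
    refine ensures_set hV (by norm_num) hℓ (henc _) ?_
    apply ensures_seq
    apply ensures_forLoop (K := r) hV (fun i M' => M' (15, 0) = M (13, 0) / 2 ^ i ∧
      M' (16, 0) = O.enc (O.dec (M (12, 0)) * O.matrix M (r * n + s)
        + ∑ j ∈ Finset.range i, if M (13, 0) / 2 ^ j % 2 = 1 ∧ own j = cls s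
            then O.matrix M (j * n + s) else 0))
      (by norm_num) hℓ hrV (by decide)
    · simp [Expr.eval, Memory.update_apply, hM.numRows]
    · simp [Expr.eval, Memory.update_apply, hM.numRows, hM.numVars, hs, Oracle.matrix]
    · rintro i hi M' hv hfr ⟨h15, h16⟩
      have hf : ∀ a, a = 4 ∨ a = 0 ∨ a = 5 ∨ a = 2 ∨ a = 14 → ∀ j, M' (a, j) = M (a, j) := by
        rintro a ha j
        have : a ≠ 15 ∧ a ≠ 16 := by omega
        rw [hfr a (by rcases ha with rfl | rfl | rfl | rfl | rfl <;> decide)]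
        simp [Memory.update_apply, this]
      have h14 : M' (14, 0) = s := by rw [hf _ (by simp), hs]
      apply Ensures.of_bounded
      intro hMb'
      -- shifting array `15` prepares the bit of the next row
      have hshift : ∀ N : Memory, N (15, 0) = M (13, 0) / 2 ^ i →
          (Expr.div (rd 15) (.const 2)).eval O N = M (13, 0) / 2 ^ (i + 1) := by
        intro N hN
        simp [Expr.eval, hN, Nat.div_div_eq_div_mul, pow_succ]
      have hdiv : M (13, 0) / 2 ^ (i + 1) < V :=
        (Nat.div_le_self _ _).trans_lt (hMb.lt (by omega) _)
      have htest := eval_rowTest_ne_zero (O := O) (M := M')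
      rw [h15, hv, h14, hf 5 (by simp), hf 2 (by simp), hM.owner i hi, hM.part] at htest
      apply ensures_seq
      apply ensures_ite hV
      · intro ht
        refine ensures_set hV (by norm_num) hℓ (henc _) ?_
        apply ensures_set hV (by norm_num) hℓ
        · rw [hshift _ (by simp [Memory.update_apply, h15])]; exact hdiv
        · rw [hshift _ (by simp [Memory.update_apply, h15])]
          refine ⟨by simp [Expr.eval, Memory.update_apply], ?_⟩
          rw [Finset.sum_range_succ, if_pos (htest.1 ht)]
          simp [Expr.eval, Memory.update_apply, h16, hv, h14, hf, hM.numVars, Oracle.matrix,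
            add_assoc]
      · intro ht
        refine (ensures_skip ?_).mono (Nat.succ_le_succ (Nat.zero_le _)) fun _ _ h => h
        apply ensures_set hV (by norm_num) hℓ
        · rw [hshift _ h15]; exact hdiv
        · rw [hshift _ h15]
          refine ⟨by simp [Expr.eval, Memory.update_apply], ?_⟩
          rw [Finset.sum_range_succ, if_neg (mt htest.2 (not_not.2 ht))]
          simp [Expr.eval, Memory.update_apply, h16]
    · rintro M' hfr ⟨h15, h16⟩
      have h14 : M' (14, 0) = s := by
        rw [hfr 14 (by decide)]; simp [Expr.eval, hs]
      have h18 : ∀ t, M' (18, t) = M (18, t) := fun t => by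
        rw [hfr 18 (by decide)]; simp
      have hs' : (rd 14).eval O M' = s := h14
      have hv' : (rd 16).eval O M' = _ := h16
      apply ensures_set hV (by norm_num)
      · rw [hs']; nlinarith
      · rw [hv']; exact henc _
      · rw [hs', hv']
        refine ⟨by rw [Memory.update_apply, if_pos rfl, sievePoint], fun t ht => ?_⟩
        rw [Memory.update_apply, if_neg (by simpa using ht), h18]
  case hT =>
    simp only [Expr.cost, rowTest]
    nlinarith
  case hQ =>
    rintro M' _ ⟨h1, h2⟩
    exact ⟨by rw [h1, O.dec_enc], h2⟩

theorem ensures_computePoint (hC : Capacity F n ℓ V) {M : Memory} (hM : Prepared cls own r M)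
    (hr : r ≤ n) :
    Ensures O ℓ V computePoint (120 * (n + 1) ^ 2) M fun M' =>
      ∀ s : Fin n, O.dec (M' (18, (s : ℕ)))
        = sievePoint cls own r (O.matrix M) (O.dec (M (12, 0))) (M (13, 0)) s := by
  have hsq := hC.sq
  have had := hC.address
  apply Ensures.mono
  case h =>
    apply ensures_forLoop (K := n) hC.field (fun i M' => ∀ s : Fin n, (s : ℕ) < i →
      O.dec (M' (18, (s : ℕ)))
        = sievePoint cls own r (O.matrix M) (O.dec (M (12, 0))) (M (13, 0)) s)
      (by norm_num) (by omega) (by nlinarith) (by decide)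
    · simp [Expr.eval, hM.numVars]
    · intro s hs; omega
    · intro i hi M' hv hfr hinv
      have hf : ∀ a, a = 0 ∨ a = 2 ∨ a = 5 ∨ a = 6 ∨ a = 7 ∨ a = 4 ∨ a = 12 ∨ a = 13 →
          ∀ j, M' (a, j) = M (a, j) := fun a ha j =>
        hfr a (by rcases ha with rfl | rfl | rfl | rfl | rfl | rfl | rfl | rfl <;> decide) j
      have hm : O.matrix M' = O.matrix M := funext fun t => by
        rw [Oracle.matrix, Oracle.matrix, hf 4 (by simp)]
      have hP : Prepared cls own r M' := hM.congr fun a ha => hf a (by tauto)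
      refine (ensures_computeEntry hC hP hr (s := ⟨i, hi⟩) hv).mono le_rfl ?_
      rintro M'' _ ⟨h1, h2⟩ s hs
      rw [Memory.update_apply, if_neg (by simp)]
      by_cases hsi : (s : ℕ) = i
      · obtain rfl : s = ⟨i, hi⟩ := Fin.ext hsi
        rw [h1, hm, hf 12 (by simp), hf 13 (by simp)]
      · rw [h2 _ hsi, hinv s (by omega)]
    · exact fun M' _ h => h
  case hT =>
    simp only [Expr.cost]
    nlinarith
  case hQ => exact fun M' _ h s => h s s.isLt

theorem ensures_computeWeight (hC : Capacity F n ℓ V) {M : Memory} (hM : M (0, 1) = p)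
    (hp : p ≤ n) :
    Ensures O ℓ V computeWeight (100 * (n + 1)) M fun M' =>
      M' (11, 0) = O.enc (lagrangeWeight p O.dec (M (12, 0))) := by
  have hV := hC.field
  have hsq := hC.sq
  have had := hC.address
  have henc : ∀ x, O.enc x < V := fun x => (O.enc_lt x).trans_le hV
  have hℓ : 0 < ℓ := by omega
  apply Ensures.mono (Q := fun M' =>
    M' (11, 0) = O.enc (lagrangeWeight p O.dec (M (12, 0)))) 
  case h =>
    apply ensures_seq
    refine ensures_set hV (by norm_num) hℓ (henc _) ?_
    apply ensures_forLoop (K := p + 1) hV (fun i M' => M' (11, 0) = O.enc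
      (∏ j ∈ (Finset.range i).erase (M (12, 0)), (O.dec (M (12, 0)) + O.dec j)⁻¹))
      (by norm_num) hℓ (by nlinarith) (by decide)
    · simp [Expr.eval, Memory.update_apply, hM]
    · simp [Expr.eval, Memory.update_apply]
    · intro i hi M' hv hfr hinv
      have h12 : M' (12, 0) = M (12, 0) := by
        rw [hfr 12 (by decide)]; simp
      have htest := eval_neq_ne_zero (O := O) (M := M') (e := rd 12) (f := rd 19)
      simp only [Expr.eval, hv, h12] at htest
      apply ensures_ite hV
      · intro ht
        refine ensures_set hV (by norm_num) hℓ (henc _) ?_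
        simp only [Expr.eval, hv, h12] at ht
        rw [Finset.range_add_one, Finset.erase_insert_of_ne (by omega),
          Finset.prod_insert (by simp)]
        simp [Expr.eval, Memory.update_apply, hinv, h12, hv, mul_comm]
      · intro ht
        refine (ensures_skip ?_).mono (Nat.succ_le_succ (Nat.zero_le _)) fun _ _ h => h
        simp only [Expr.eval, hv, h12] at ht
        have : M (12, 0) = i := by omega
        rw [Memory.update_apply, if_neg (by simp), hinv, this, Finset.range_add_one,
          Finset.erase_insert_eq_erase]
    · intro M' _ h
      exact h
  case hT =>
    simp only [Expr.cost]
    nlinarith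
  case hQ => exact fun _ _ h => h

theorem ensures_accumulate (hC : Capacity F n ℓ V) {M : Memory} (hM : Prepared cls own r M)
    (hr : r ≤ n) {S w : F} (hS : M (10, 0) = O.enc S) (hw : M (11, 0) = O.enc w) :
    Ensures O ℓ V accumulate (200 * (n + 1) ^ 2 * 2 ^ r) M fun M' =>
      M' (10, 0) = O.enc (S + ∑ m ∈ Finset.range (2 ^ r), w * MvPolynomial.eval
        (sievePoint cls own r (O.matrix M) (O.dec (M (12, 0))) m) O.poly) := by
  have hV := hC.field
  have hsq := hC.sq
  have had := hC.address
  have henc : ∀ x, O.enc x < V := fun x => (O.enc_lt x).trans_le hV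
  have hℓ : 0 < ℓ := by omega
  have hpow := (Nat.pow_le_pow_right (n := 2) (by norm_num) hr).trans_lt hC.pow
  apply Ensures.mono (Q := fun M' =>
    M' (10, 0) = O.enc (S + ∑ m ∈ Finset.range (2 ^ r), w * MvPolynomial.eval
        (sievePoint cls own r (O.matrix M) (O.dec (M (12, 0))) m) O.poly)) 
  case h =>
    apply ensures_forLoop (K := 2 ^ r) hV (fun i M' =>
      M' (10, 0) = O.enc (S + ∑ m ∈ Finset.range i, w * MvPolynomial.eval
        (sievePoint cls own r (O.matrix M) (O.dec (M (12, 0))) m) O.poly))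
      (by norm_num) hℓ hpow (by decide)
    · simp [Expr.eval, Memory.update_apply, hM.pow]
    · simp [Memory.update_apply, hS]
    · intro i hi M' hv hfr hinv
      have hf : ∀ a, a = 0 ∨ a = 2 ∨ a = 5 ∨ a = 6 ∨ a = 7 ∨ a = 4 ∨ a = 11 ∨ a = 12 →
          ∀ j, M' (a, j) = M (a, j) := fun a ha j =>
        hfr a (by rcases ha with rfl | rfl | rfl | rfl | rfl | rfl | rfl | rfl <;> decide) j
      have hm : O.matrix M' = O.matrix M := funext fun t => by
        rw [Oracle.matrix, Oracle.matrix, hf 4 (by simp)]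
      have hP : Prepared cls own r M' := hM.congr fun a ha => hf a (by tauto)
      apply ensures_seq
      refine ((ensures_computePoint hC hP hr).frame).mono le_rfl ?_
      rintro M'' _ ⟨hpt, hfr'⟩
      refine ensures_set hV (by norm_num) hℓ (henc _) ?_
      have h10 : M'' (10, 0) = M' (10, 0) := hfr' 10 (by decide) 0
      have h11 : M'' (11, 0) = O.enc w := by
        rw [hfr' 11 (by decide), hf 11 (by simp), hw]
      have hpt' : (fun x : Fin n => O.dec (M'' (18, (x : ℕ))))
          = sievePoint cls own r (O.matrix M) (O.dec (M (12, 0))) i := by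
        funext x
        rw [hpt, hm, hf 12 (by simp), hv]
      rw [Finset.sum_range_succ, ← add_assoc]
      simp [Expr.eval, Memory.update_apply, h10, h11, hinv, hpt']
    · intro M' _ h
      exact h
  case hT =>
    have h1 : 1 ≤ 2 ^ r := Nat.one_le_two_pow
    have h2 : 2 ^ r ≤ (n + 1) ^ 2 * 2 ^ r := Nat.le_mul_of_pos_left _ (by positivity)
    simp only [Expr.cost]
    nlinarith
  case hQ => exact fun _ _ h => h

theorem ensures_computeSieve (hC : Capacity F n ℓ V) {M : Memory} (hM : Prepared cls own r M)
    (hr : r ≤ n) (hp : p ≤ n) :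
    Ensures O ℓ V computeSieve (400 * (n + 1) ^ 3 * 2 ^ r) M fun M' =>
      M' (10, 0) = O.enc (sieveValue cls own r O.dec O.poly (O.matrix M)) := by
  have hV := hC.field
  have hsq := hC.sq
  have had := hC.address
  have henc : ∀ x, O.enc x < V := fun x => (O.enc_lt x).trans_le hV
  have hℓ : 0 < ℓ := by omega
  apply Ensures.mono (Q := fun M' =>
    M' (10, 0) = O.enc (sieveValue cls own r O.dec O.poly (O.matrix M))) 
  case h =>
    apply ensures_seq
    refine ensures_set hV (by norm_num) hℓ (henc _) ?_
    apply ensures_forLoop (K := p + 1) hV (fun i M' => M' (10, 0) = O.enc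
      (∑ k ∈ Finset.range i, ∑ m ∈ Finset.range (2 ^ r), lagrangeWeight p O.dec k *
        MvPolynomial.eval (sievePoint cls own r (O.matrix M) (O.dec k) m) O.poly))
      (by norm_num) hℓ (by nlinarith) (by decide)
    · simp [Expr.eval, Memory.update_apply, hM.numParts]
    · simp [Expr.eval, Memory.update_apply]
    · intro i hi M' hv hfr hinv
      have hf : ∀ a, a = 0 ∨ a = 2 ∨ a = 5 ∨ a = 6 ∨ a = 7 ∨ a = 4 →
          ∀ j, M' (a, j) = M (a, j) := fun a ha j => by
        rw [hfr a (by rcases ha with rfl | rfl | rfl | rfl | rfl | rfl <;> decide) j]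
        have : a ≠ 10 := by omega
        simp [this]
      have hP : Prepared cls own r M' := hM.congr fun a ha => hf a (by tauto)
      apply ensures_seq
      refine ((ensures_computeWeight hC hP.numParts hp).frame).mono le_rfl ?_
      rintro M'' _ ⟨hw, hfr'⟩
      have hf' : ∀ a, a = 0 ∨ a = 2 ∨ a = 5 ∨ a = 6 ∨ a = 7 ∨ a = 4 ∨ a = 10 ∨ a = 12 →
          ∀ j, M'' (a, j) = M' (a, j) := fun a ha j =>
        hfr' a (by rcases ha with rfl | rfl | rfl | rfl | rfl | rfl | rfl | rfl <;> decide) j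
      have hP' : Prepared cls own r M'' := hP.congr fun a ha => hf' a (by tauto)
      have hm : O.matrix M'' = O.matrix M := funext fun t => by
        rw [Oracle.matrix, Oracle.matrix, hf' 4 (by simp), hf 4 (by simp)]
      refine (ensures_accumulate hC hP' hr ((hf' 10 (by simp) 0).trans hinv) hw).mono le_rfl ?_
      intro N _ hN
      rw [Memory.update_apply, if_neg (by simp), hN, Finset.sum_range_succ, hm,
        hf' 12 (by simp), hv]
    · intro M' _ h
      exact h
  case hT =>
    have h1 : 1 ≤ 2 ^ r := Nat.one_le_two_pow
    have h2 : (n + 1) ≤ (n + 1) ^ 2 * 2 ^ r := by nlinarith [Nat.zero_le n]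
    have h3 : p + 1 ≤ n + 1 := by omega
    simp only [Expr.cost]
    have h4 : 100 * (n + 1) + 200 * (n + 1) ^ 2 * 2 ^ r + 7 ≤ 310 * ((n + 1) ^ 2 * 2 ^ r) := by
      nlinarith
    have h5 := Nat.mul_le_mul h3 h4
    nlinarith
  case hQ => exact fun _ _ h => h

end Program

/-! ### Preparation of the row ownership -/

namespace Program

/-- Lists in array `5` the owners of the rows, each part `i` owning `c i - 1` rows, and counts the
rows in array `6`. -/
def assignRows : Program :=
  forLoop 8 (.get 0 (.const 1)) <|
    forLoop 9 (.sub (.get 1 (rd 8)) (.const 1)) <|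
      seq (set 5 (rd 6) (rd 8)) (set 6 (.const 0) (.add (rd 6) (.const 1)))

/-- Computes the number of subsets of the rows into array `7`. -/
def computePow : Program :=
  seq (set 7 (.const 0) (.const 1)) <|
  forLoop 8 (rd 6) (set 7 (.const 0) (.mul (rd 7) (.const 2)))

/-- The whole preparation. -/
def prepare : Program := seq assignRows computePow

end Program

/-- Every row listed so far is owned by a part, and part `i` owns `e i` of them. -/
def Owned {p : ℕ} (e : Fin p → ℕ) (M : Memory) : Prop :=
  (∀ j < M (6, 0), M (5, j) < p) ∧
    ∀ i : Fin p, ((Finset.range (M (6, 0))).filter fun j => M (5, j) = i).card = e i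

theorem Owned.congr {p : ℕ} {e : Fin p → ℕ} {M M' : Memory} (h : Owned e M)
    (h5 : ∀ j, M' (5, j) = M (5, j)) (h6 : M' (6, 0) = M (6, 0)) : Owned e M' := by
  simpa only [Owned, h5, h6] using h

theorem Owned.numRows_eq {p : ℕ} {e : Fin p → ℕ} {M : Memory} (h : Owned e M) :
    M (6, 0) = ∑ i, e i := by
  have h1 := Finset.card_eq_sum_card_fiberwise (s := Finset.range (M (6, 0)))
    (t := Finset.range p) (f := fun j => M (5, j))
    (fun j hj => Finset.mem_coe.2 (Finset.mem_range.2 (h.1 j (Finset.mem_range.1 hj))))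
  rw [Finset.card_range, Finset.sum_range] at h1
  rw [h1]
  exact Finset.sum_congr rfl fun i _ => h.2 i

theorem Owned.append {p : ℕ} {e e' : Fin p → ℕ} {M M' : Memory} (h : Owned e M) {i : ℕ}
    (hi : i < p) (h5 : ∀ j, M' (5, j) = if j = M (6, 0) then i else M (5, j))
    (h6 : M' (6, 0) = M (6, 0) + 1)
    (he : ∀ i' : Fin p, e' i' = e i' + if (i' : ℕ) = i then 1 else 0) : Owned e' M' := by
  constructor
  · intro j hj
    rw [h6] at hj
    rw [h5]
    split_ifs with hjr
    · exact hi
    · exact h.1 j (by omega)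
  · intro i'
    rw [h6, he, ← h.2 i', Finset.card_filter, Finset.card_filter, Finset.sum_range_succ]
    congr 1
    · refine Finset.sum_congr rfl fun j hj => ?_
      rw [h5, if_neg (Finset.mem_range.1 hj).ne]
    · rw [h5, if_pos rfl]
      simp only [eq_comm]

namespace Program

variable {F : Type*} [Field F] [Fintype F] {n p : ℕ} {O : Oracle F n} {ℓ V : ℕ}
  {cls : Fin n → Fin p} {own : ℕ → ℕ} {r : ℕ}

theorem ensures_assignRows (hC : Capacity F n ℓ V) {M : Memory} {c : Fin p → ℕ}
    (hp : M (0, 1) = p) (hc : ∀ i : Fin p, M (1, (i : ℕ)) = c i) (hr0 : M (6, 0) = 0)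
    (hcn : ∑ i, c i ≤ n) (hpn : p ≤ n) :
    Ensures O ℓ V assignRows (40 * (n + 1) ^ 2) M (Owned fun i => c i - 1) := by
  have hV := hC.field
  have hsq := hC.sq
  have had := hC.address
  have hℓ : 0 < ℓ := by omega
  have hnV : n < V := by nlinarith
  have hnℓ : n < ℓ := by nlinarith
  have hcle : ∀ i, c i ≤ n := fun i =>
    (Finset.single_le_sum (fun _ _ => Nat.zero_le _) (Finset.mem_univ i)).trans hcn
  apply Ensures.mono
  case h =>
    apply ensures_forLoop (K := p) hV
      (fun i => Owned fun i' : Fin p => if (i' : ℕ) < i then c i' - 1 else 0)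
      (by norm_num) hℓ (by omega) (by decide)
    · simp [Expr.eval, Memory.update_apply, hp]
    · constructor
      · intro j hj
        simp [Memory.update_apply, hr0] at hj
      · intro i
        simp [Memory.update_apply, hr0]
    · intro i hi M' hv hfr hinv
      have h1 : M' (1, i) = c ⟨i, hi⟩ := by rw [hfr 1 (by decide), ← hc]
      apply Ensures.mono (T' := 9 + n * 18)
      case h =>
        apply ensures_forLoop (K := c ⟨i, hi⟩ - 1) hV
          (fun k => Owned fun i' : Fin p =>
            if (i' : ℕ) < i then c i' - 1 else if (i' : ℕ) = i then k else 0)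
          (by norm_num) hℓ (by have := hcle ⟨i, hi⟩; omega) (by decide)
        · simp [Expr.eval, Memory.update_apply, hv, h1]
        · refine Owned.congr (M := M') ?_ (by simp [Memory.update_apply])
            (by simp [Memory.update_apply])
          simpa using hinv
        · intro k hk M'' hv' hfr' hinv'
          have h8 : M'' (8, 0) = i := by rw [hfr' 8 (by decide), hv]
          have hrow : M'' (6, 0) < n := by
            rw [hinv'.numRows_eq]
            refine lt_of_lt_of_le (Finset.sum_lt_sum (g := c) (fun i' _ => ?_)
              ⟨⟨i, hi⟩, Finset.mem_univ _, ?_⟩) hcn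
            · split_ifs with h2 h3
              · omega
              · obtain rfl : i' = ⟨i, hi⟩ := Fin.ext h3
                omega
              · omega
            · simp only [lt_irrefl, if_false, if_true]
              omega
          have he6 : (rd 6).eval O M'' = M'' (6, 0) := rfl
          have he8 : (rd 8).eval O M'' = i := h8
          apply ensures_seq
          refine ensures_set hV (by norm_num) (by rw [he6]; omega) (by rw [he8]; omega) ?_
          rw [he6, he8]
          refine ensures_set hV (by norm_num) hℓ (by
            simp [Expr.eval, Memory.update_apply]; omega) ?_
          refine hinv'.append hi (fun j => ?_) ?_ fun i' => ?_
          · simp [Expr.eval, Memory.update_apply]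
          · simp [Expr.eval, Memory.update_apply]
          · split_ifs <;> omega
        · intro M'' _ h
          exact h
      case hT =>
        have := hcle ⟨i, hi⟩
        simp only [Expr.cost]
        have : c ⟨i, hi⟩ - 1 ≤ n := by omega
        nlinarith
      case hQ =>
        intro M'' _ h
        refine Owned.congr (M := M'') ?_ (by simp [Memory.update_apply])
          (by simp [Memory.update_apply])
        convert h using 2 with i'
        split_ifs with h2 h3 h4
        · rfl
        · obtain rfl : i' = ⟨i, hi⟩ := Fin.ext h4
          rfl
        all_goals omega
    · intro M' _ h
      exact h
  case hT =>
    simp only [Expr.cost]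
    nlinarith
  case hQ =>
    intro M' _ h
    simpa using h

theorem ensures_computePow (hC : Capacity F n ℓ V) {M : Memory} (hr : M (6, 0) = r)
    (hrn : r ≤ n) :
    Ensures O ℓ V computePow (40 * (n + 1)) M fun M' => M' (7, 0) = 2 ^ r := by
  have hV := hC.field
  have hsq := hC.sq
  have had := hC.address
  have hℓ : 0 < ℓ := by omega
  have hrV : r < V := by nlinarith
  have h1V : 1 < V := lt_of_le_of_lt Nat.one_le_two_pow hC.pow
  apply Ensures.mono
  case h =>
    apply ensures_seq
    refine ensures_set hV (by norm_num) hℓ h1V ?_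
    apply ensures_forLoop (K := r) hV (fun i M' => M' (7, 0) = 2 ^ i)
      (by norm_num) hℓ hrV (by decide)
    · simp [Expr.eval, Memory.update_apply, hr]
    · simp [Expr.eval, Memory.update_apply]
    · intro i hi M' hv hfr hinv
      have hlt : 2 ^ (i + 1) < V :=
        (Nat.pow_le_pow_right (by norm_num) (by omega)).trans_lt hC.pow
      have he : (Expr.mul (rd 7) (.const 2)).eval O M' = 2 ^ (i + 1) := by
        simp [Expr.eval, hinv, pow_succ]
      refine ensures_set hV (by norm_num) hℓ (he ▸ hlt) ?_
      rw [he]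
      simp [Expr.eval, Memory.update_apply]
    · intro M' _ h
      exact h
  case hT =>
    simp only [Expr.cost]
    nlinarith
  case hQ => exact fun _ _ h => h

/-- After the preparation, every part owns one row less than its capacity, and the number of rows
is `d - p`. -/
theorem ensures_prepare (hC : Capacity F n ℓ V) {M : Memory} {c : Fin p → ℕ}
    (hn : M (0, 0) = n) (hp : M (0, 1) = p) (hc : ∀ i : Fin p, M (1, (i : ℕ)) = c i)
    (hcls : ∀ x : Fin n, M (2, (x : ℕ)) = cls x) (hr0 : M (6, 0) = 0)
    (h1c : ∀ i, 1 ≤ c i) (hcr : ∑ i, c i = r + p) (hrp : r + p ≤ n) :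
    Ensures O ℓ V prepare (80 * (n + 1) ^ 2) M fun M' =>
      ∃ own, Prepared cls own r M' ∧ (∀ j : Fin r, own j < p) ∧
        (∀ i : Fin p, (Finset.univ.filter fun j : Fin r => own j = i).card + 1 = c i) ∧
        M' (3, 0) = M (3, 0) := by
  have hsum : ∑ i, (c i - 1) = r := by
    have : ∑ i, (c i - 1) + p = ∑ i, c i := by
      rw [← Finset.sum_congr rfl fun i _ => Nat.sub_add_cancel (h1c i), Finset.sum_add_distrib]
      simp
    omega
  apply Ensures.mono (Q := fun M' =>
      ∃ own, Prepared cls own r M' ∧ (∀ j : Fin r, own j < p) ∧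
        (∀ i : Fin p, (Finset.univ.filter fun j : Fin r => own j = i).card + 1 = c i) ∧
        M' (3, 0) = M (3, 0))
  case h =>
    apply ensures_seq
    refine ((ensures_assignRows hC hp hc hr0 (by omega) (by omega)).frame).mono le_rfl ?_
    rintro M₁ _ ⟨hown, hfr⟩
    have hr : M₁ (6, 0) = r := by rw [hown.numRows_eq, hsum]
    refine ((ensures_computePow hC hr (by omega)).frame).mono le_rfl ?_
    rintro M₂ _ ⟨hpow, hfr'⟩
    have h5 : ∀ j, M₂ (5, j) = M₁ (5, j) := hfr' 5 (by decide)
    have h02 : ∀ a, a = 0 ∨ a = 2 ∨ a = 3 → ∀ j, M₂ (a, j) = M (a, j) := by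
      intro a ha j
      rw [hfr' a (by rcases ha with rfl | rfl | rfl <;> decide),
        hfr a (by rcases ha with rfl | rfl | rfl <;> decide)]
    refine ⟨fun j => M₁ (5, j), ?_, ?_, ?_, h02 3 (by simp) 0⟩
    · constructor
      · rw [h02 0 (by simp), hn]
      · rw [h02 0 (by simp), hp]
      · intro x; rw [h02 2 (by simp), hcls]
      · intro j _; exact h5 j
      · rw [hfr' 6 (by decide), hr]
      · exact hpow
    · intro j
      exact hown.1 j (hr ▸ j.isLt)
    · intro i
      have h1 : ((Finset.range (M₁ (6, 0))).filter fun j => M₁ (5, j) = i).card = c i - 1 :=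
        hown.2 i
      have h2 := h1c i
      change (Finset.univ.filter fun j : Fin r => M₁ (5, (j : ℕ)) = i).card + 1 = c i
      rw [hr, Finset.card_filter, Finset.sum_range, ← Finset.card_filter] at h1
      omega
  case hT => nlinarith
  case hQ => exact fun _ _ h => h

/-! ### A single round -/

theorem ensures_draw (hC : Capacity F n ℓ V) {M : Memory} (hM : Prepared cls own r M)
    (hr : r ≤ n) : Ensures O ℓ V draw (40 * (n + 1) ^ 2) M fun _ => True := by
  have hV := hC.field
  have hsq := hC.sq
  have had := hC.address
  have hℓ : 0 < ℓ := by omega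
  have hL : (r + 1) * n ≤ (n + 1) * (n + 1) := Nat.mul_le_mul (by omega) (by omega)
  apply Ensures.mono
  case h =>
    apply ensures_forLoop (K := (r + 1) * n) hV (fun _ _ => True)
      (by norm_num) hℓ (by omega) (by decide)
    · simp [Expr.eval, Memory.update_apply, hM.numRows, hM.numVars]
    · trivial
    · intro i hi M' hv _ _
      have he : (rd 8).eval O M' = i := hv
      exact ensures_rand hV (by norm_num) (by rw [he]; omega) fun _ => trivial
    · exact fun _ _ _ => trivial
  case hT =>
    simp only [Expr.cost]
    nlinarith
  case hQ => exact fun _ _ _ => trivial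

/-- Evaluating the sieve raises the flag exactly if the value is nonzero. -/
theorem ensures_computeSieve_raiseFlag (hC : Capacity F n ℓ V) {M : Memory}
    (hM : Prepared cls own r M) (hr : r ≤ n) (hp : p ≤ n) :
    Ensures O ℓ V (seq computeSieve raiseFlag) (420 * (n + 1) ^ 3 * 2 ^ r) M fun M' =>
      M' (3, 0) ≠ 0 ↔ M (3, 0) ≠ 0 ∨ sieveValue cls own r O.dec O.poly (O.matrix M) ≠ 0 := by
  have hV := hC.field
  have hsq := hC.sq
  have had := hC.address
  have hℓ : 0 < ℓ := by omega
  have h1V : 1 < V := lt_of_le_of_lt Nat.one_le_two_pow hC.pow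
  apply Ensures.mono (Q := fun M' : Memory =>
    M' (3, 0) ≠ 0 ↔ M (3, 0) ≠ 0 ∨ sieveValue cls own r O.dec O.poly (O.matrix M) ≠ 0)
  case h =>
    apply ensures_seq
    refine ((ensures_computeSieve hC hM hr hp).frame).mono le_rfl ?_
    rintro M' _ ⟨hval, hfr⟩
    have h3 := hfr 3 (by decide) 0
    have htest := eval_neq_ne_zero (O := O) (M := M') (e := rd 10) (f := .fzero)
    have hinj : O.enc (sieveValue cls own r O.dec O.poly (O.matrix M)) = O.enc 0 ↔
        sieveValue cls own r O.dec O.poly (O.matrix M) = 0 :=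
      ⟨fun h => by simpa using congrArg O.dec h, fun h => by rw [h]⟩
    have he : (rd 10).eval O M' ≠ Expr.fzero.eval O M' ↔
        sieveValue cls own r O.dec O.poly (O.matrix M) ≠ 0 :=
      not_congr (show M' (10, 0) = O.enc 0 ↔ _ by rw [hval]; exact hinj)
    rw [he] at htest
    apply ensures_ite hV
    · intro ht
      refine ensures_set hV (by norm_num) hℓ h1V ?_
      simp [Expr.eval, Memory.update_apply, htest.1 ht]
    · intro ht
      refine (ensures_skip ?_).mono (Nat.succ_le_succ (Nat.zero_le _)) fun _ _ h => h
      rw [h3]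
      have : ¬ sieveValue cls own r O.dec O.poly (O.matrix M) ≠ 0 := mt htest.2 (not_not.2 ht)
      tauto
  case hT =>
    have h1 : 1 ≤ 2 ^ r := Nat.one_le_two_pow
    have h2 : 1 ≤ (n + 1) ^ 3 := Nat.one_le_pow _ _ (by omega)
    simp only [Expr.cost]
    nlinarith
  case hQ => exact fun _ _ h => h

/-- A round keeps the preparation, never lowers the flag, and raises it only if the sieve is not
identically zero. -/
theorem ensures_round (hC : Capacity F n ℓ V) {M : Memory} (hM : Prepared cls own r M)
    (hr : r ≤ n) (hp : p ≤ n) :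
    Ensures O ℓ V round (500 * (n + 1) ^ 3 * 2 ^ r) M fun M' => Prepared cls own r M' ∧
      (M (3, 0) ≠ 0 → M' (3, 0) ≠ 0) ∧
      (M' (3, 0) ≠ 0 → M (3, 0) ≠ 0 ∨ ∃ g, sieveValue cls own r O.dec O.poly g ≠ 0) := by
  have hfr : Ensures O ℓ V round _ M _ := Ensures.frame (T := 500 * (n + 1) ^ 3 * 2 ^ r)
    (Q := fun M' => (M (3, 0) ≠ 0 → M' (3, 0) ≠ 0) ∧
      (M' (3, 0) ≠ 0 → M (3, 0) ≠ 0 ∨ ∃ g, sieveValue cls own r O.dec O.poly g ≠ 0)) ?_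
  · refine hfr.mono le_rfl ?_
    rintro M' _ ⟨h, hfr⟩
    exact ⟨hM.congr fun a ha =>
      hfr a (by rcases ha with rfl | rfl | rfl | rfl | rfl <;> decide), h⟩
  apply Ensures.mono (Q := fun M' => (M (3, 0) ≠ 0 → M' (3, 0) ≠ 0) ∧
      (M' (3, 0) ≠ 0 → M (3, 0) ≠ 0 ∨ ∃ g, sieveValue cls own r O.dec O.poly g ≠ 0))
  case h =>
    apply ensures_seq
    refine ((ensures_draw hC hM hr).frame).mono le_rfl ?_
    rintro M' _ ⟨_, hfr⟩
    have hM' : Prepared cls own r M' := hM.congr fun a ha =>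
      hfr a (by rcases ha with rfl | rfl | rfl | rfl | rfl <;> decide)
    refine (ensures_computeSieve_raiseFlag hC hM' hr hp).mono le_rfl ?_
    intro M'' _ h
    rw [hfr 3 (by decide)] at h
    exact ⟨fun h3 => h.2 (Or.inl h3), fun h3 => (h.1 h3).imp id fun hv => ⟨_, hv⟩⟩
  case hT =>
    have h1 : 1 ≤ 2 ^ r := Nat.one_le_two_pow
    have h2 : (n + 1) ^ 2 ≤ (n + 1) ^ 3 * 2 ^ r :=
      (Nat.pow_le_pow_right (by omega) (by norm_num)).trans (Nat.le_mul_of_pos_right _ (by omega))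
    nlinarith
  case hQ => exact fun _ _ h => h

end Program

/-! ### The probability of failure -/

theorem toOuterMeasure_bind_le {α β : Type*} (μ : PMF α) (f : α → PMF β) {S : Set β} {A : Set α}
    {ε : ENNReal} (h₀ : ∀ x ∈ μ.support, x ∉ A → (f x).toOuterMeasure S = 0)
    (h₁ : ∀ x ∈ μ.support, x ∈ A → (f x).toOuterMeasure S ≤ ε) :
    (μ.bind f).toOuterMeasure S ≤ μ.toOuterMeasure A * ε := by
  rw [PMF.toOuterMeasure_bind_apply, PMF.toOuterMeasure_apply, ← ENNReal.tsum_mul_right]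
  refine ENNReal.tsum_le_tsum fun x => ?_
  by_cases hx : x ∈ μ.support
  · by_cases hA : x ∈ A
    · rw [Set.indicator_of_mem hA]
      exact mul_le_mul_right (h₁ x hx hA) _
    · rw [h₀ x hx hA, mul_zero]
      exact zero_le
  · rw [(PMF.apply_eq_zero_iff μ x).2 hx, zero_mul]
    exact zero_le

theorem toOuterMeasure_le_one {α : Type*} (μ : PMF α) (S : Set α) : μ.toOuterMeasure S ≤ 1 := by
  rw [PMF.toOuterMeasure_apply, ← μ.tsum_coe]
  exact ENNReal.tsum_le_tsum fun x => Set.indicator_le_self _ _ x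

theorem overwrite_cons {F : Type*} (g : ℕ → F) (i k : ℕ) (x : F) (v : Fin k → F) :
    overwrite g i (Fin.cons x v : Fin (k + 1) → F)
      = overwrite (Function.update g i x) (i + 1) v := by
  funext t
  simp only [overwrite]
  by_cases hti : t = i
  · subst hti
    simp
  · by_cases h : i + 1 ≤ t ∧ t - (i + 1) < k
    · rw [dif_pos h, dif_pos (by omega)]
      have : (⟨t - i, by omega⟩ : Fin (k + 1)) = Fin.succ ⟨t - (i + 1), h.2⟩ :=
        Fin.ext (by simp; omega)
      rw [this, Fin.cons_succ]
    · rw [dif_neg h, dif_neg (by omega), Function.update_of_ne hti]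

namespace Program

variable {F : Type*} [Field F] [Fintype F] {n p : ℕ} {O : Oracle F n} {ℓ V : ℕ}
  {cls : Fin n → Fin p} {own : ℕ → ℕ} {r : ℕ}

theorem run_rand_step (b i : ℕ) (s : RunState) (hs : s.mem (8, 0) = i) :
    ∃ G : F → RunState,
      (seq (rand 4 (rd 8)) (set 8 (.const 0) (.add (rd 8) (.const 1)))).run O b s
        = (PMF.uniformOfFintype F).bind (fun x => PMF.pure (G x)) ∧
      ∀ x, (G x).mem = (s.mem.update (4, i) (O.enc x)).update (8, 0) (i + 1) := by
  simp only [run, PMF.bind_bind, PMF.pure_bind]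
  refine ⟨_, rfl, fun x => ?_⟩
  simp [RunState.write, RunState.charge, Expr.eval, hs, Memory.update_apply]

open Classical in
/-- The body of the drawing loop, run `k` times, fills `k` consecutive entries of the matrix with
independent uniformly random elements. -/
theorem toOuterMeasure_repeatRun_rand (b k i : ℕ) (s : RunState) (hs : s.mem (8, 0) = i)
    (E : (ℕ → F) → Prop) :
    (RunState.repeatRun ((seq (rand 4 (rd 8)) (set 8 (.const 0) (.add (rd 8) (.const 1)))).run O b)
        k s).toOuterMeasure {s' | E (O.matrix s'.mem)}
      = ∑ v : Fin k → F, if E (overwrite (O.matrix s.mem) i v)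
          then (Fintype.card F : ENNReal)⁻¹ ^ k else 0 := by
  induction k generalizing i s with
  | zero =>
    have : ∀ v : Fin 0 → F, overwrite (O.matrix s.mem) i v = O.matrix s.mem := fun v => by
      funext t
      simp [overwrite]
    simp [RunState.repeatRun, PMF.toOuterMeasure_pure_apply, this]
  | succ k ih =>
    obtain ⟨G, hrun, hG⟩ := run_rand_step (O := O) b i (s.charge 1 0) hs
    rw [RunState.repeatRun, hrun, PMF.bind_bind]
    simp only [PMF.pure_bind]
    rw [PMF.toOuterMeasure_bind_apply, tsum_fintype,
      ← (Fin.consEquiv (fun _ : Fin (k + 1) => F)).sum_comp, Fintype.sum_prod_type]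
    refine Finset.sum_congr rfl fun x _ => ?_
    have hmat : O.matrix (G x).mem = Function.update (O.matrix s.mem) i x := by
      funext t
      rw [Oracle.matrix, hG, Memory.update_apply, if_neg (by simp), Memory.update_apply,
        Function.update_apply]
      by_cases ht : t = i
      · simp [ht]
      · simp [ht, Oracle.matrix, RunState.charge]
    rw [ih (i + 1) (G x) (by rw [hG, Memory.update_apply, if_pos rfl]),
      PMF.uniformOfFintype_apply, Finset.mul_sum]
    refine Finset.sum_congr rfl fun v _ => ?_
    have hcons : overwrite (O.matrix s.mem) i ((Fin.consEquiv fun _ => F) (x, v))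
        = overwrite (O.matrix (G x).mem) (i + 1) v := by
      rw [hmat]
      exact overwrite_cons _ _ _ _ _
    rw [mul_ite, mul_zero, ← pow_succ', hcons]

/-- If the sieve is not identically zero, it vanishes for a random matrix with probability at most
`d / |F|`. -/
theorem toOuterMeasure_draw_le {d : ℕ} (hP : O.poly.totalDegree ≤ d)
    (hne : ∃ g, sieveValue cls own r O.dec O.poly g ≠ 0) (b : ℕ) (s : RunState)
    (hs : Prepared cls own r s.mem) :
    (draw.run O b s).toOuterMeasure
        {s' | sieveValue cls own r O.dec O.poly (O.matrix s'.mem) = 0}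
      ≤ d / Fintype.card F := by
  classical
  have h0 : ((Expr.mul (.add (rd 6) (.const 1)) (rd 0)).eval O (s.mem.update (8, 0) 0))
      = (r + 1) * n := by
    simp [Expr.eval, Memory.update_apply, hs.numRows, hs.numVars]
  have hq : (Fintype.card F : ENNReal) ≠ 0 := by simp
  have hq' : (Fintype.card F : ENNReal) ≠ ⊤ := ENNReal.natCast_ne_top _
  rw [draw, forLoop, run, run, PMF.pure_bind, run]
  change (RunState.repeatRun _ ((Expr.mul (.add (rd 6) (.const 1)) (rd 0)).eval O
    (s.mem.update (8, 0) 0)) _).toOuterMeasure _ ≤ _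
  rw [h0, toOuterMeasure_repeatRun_rand _ _ 0 _
    (by simp [RunState.write, RunState.charge, Expr.eval])
    (fun g => sieveValue cls own r O.dec O.poly g = 0)]
  rw [← Finset.sum_filter, Finset.sum_const, nsmul_eq_mul, ENNReal.le_div_iff_mul_le
    (Or.inl hq) (Or.inl hq'), mul_right_comm, ← ENNReal.inv_pow,
    ENNReal.mul_inv_le_iff (pow_ne_zero _ hq) (ENNReal.pow_ne_top hq')]
  exact_mod_cast card_sieveValue_eq_zero_le cls own r O.dec O.poly hP _ hne

/-- A round misses a sieve that is not identically zero with probability at most `d / |F|`. -/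
theorem toOuterMeasure_round_le (hC : Capacity F n ℓ V) {d : ℕ} (hP : O.poly.totalDegree ≤ d)
    (hr : r ≤ n) (hp : p ≤ n)
    (hne : ∃ g, sieveValue cls own r O.dec O.poly g ≠ 0) (b : ℕ) (s : RunState)
    (hs : Prepared cls own r s.mem) (hb : s.mem.Bounded ℓ V) :
    (round.run O b s).toOuterMeasure {s' | s'.mem (3, 0) = 0} ≤ d / Fintype.card F := by
  rw [round, run]
  refine (toOuterMeasure_bind_le _ _ (ε := 1)
    (A := {s' | sieveValue cls own r O.dec O.poly (O.matrix s'.mem) = 0}) ?_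
    fun _ _ _ => toOuterMeasure_le_one _ _).trans ?_
  · intro t ht htA
    obtain ⟨⟨_, hfr⟩, hbt, _⟩ := ((ensures_draw hC hs hr).frame) b s rfl hb t ht
    have hst : Prepared cls own r t.mem := hs.congr fun a ha =>
      hfr a (by rcases ha with rfl | rfl | rfl | rfl | rfl <;> decide)
    rw [PMF.toOuterMeasure_apply_eq_zero_iff, Set.disjoint_left]
    intro t' ht' ht0
    have := (ensures_computeSieve_raiseFlag hC hst hr hp b t rfl hbt t' ht').1
    exact this.2 (Or.inr htA) ht0
  · rw [mul_one]
    exact toOuterMeasure_draw_le hP hne b s hs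

/-- The rounds are independent, so that the probability of failure decreases exponentially. -/
theorem toOuterMeasure_repeatRun_round_le (hC : Capacity F n ℓ V) {d : ℕ}
    (hP : O.poly.totalDegree ≤ d) (hr : r ≤ n) (hp : p ≤ n)
    (hne : ∃ g, sieveValue cls own r O.dec O.poly g ≠ 0) (b k : ℕ) (s : RunState)
    (hs : Prepared cls own r s.mem) (hb : s.mem.Bounded ℓ V) :
    (RunState.repeatRun (round.run O b) k s).toOuterMeasure {s' | s'.mem (3, 0) = 0}
      ≤ (d / Fintype.card F : ENNReal) ^ k := by
  induction k generalizing s with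
  | zero =>
    rw [pow_zero]
    exact toOuterMeasure_le_one _ _
  | succ k ih =>
    rw [RunState.repeatRun, pow_succ']
    have hround := ensures_round (O := O) hC hs hr hp b (s.charge 1 0) rfl hb
    refine (toOuterMeasure_bind_le _ _ (A := {s' | s'.mem (3, 0) = 0}) ?_ ?_).trans
      (mul_le_mul_left (toOuterMeasure_round_le hC hP hr hp hne b (s.charge 1 0) hs hb) _)
    · intro t ht htA
      obtain ⟨⟨hst, _⟩, hbt, _⟩ := hround t ht
      rw [PMF.toOuterMeasure_apply_eq_zero_iff, Set.disjoint_left]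
      intro t' ht' ht0
      refine (mem_of_repeatRun (i := 0) (Inv := fun _ u => Prepared cls own r u.mem ∧
        u.mem.Bounded ℓ V ∧ u.mem (3, 0) ≠ 0) ⟨hst, hbt, htA⟩ ?_ ht').2.2 ht0
      rintro j u _ ⟨hu, hbu, hu3⟩ u' hu'
      obtain ⟨⟨h1, h2, _⟩, h3, _⟩ :=
        ensures_round (O := O) hC hu hr hp b (u.charge 1 0) rfl hbu u' hu'
      exact ⟨h1, h3, h2 hu3⟩
    · intro t ht _
      obtain ⟨⟨hst, _⟩, hbt, _⟩ := hround t ht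
      exact ih t hst hbt

end Program

/-- With `a (n + 1) (n + 2)` rounds, the probability of failure is as small as required. -/
theorem failure_pow_le {n d q : ℕ} (a : ℕ) (hd : d ≤ n) (hq : d < q) :
    (d / q : ENNReal) ^ (a * ((n + 1) * (n + 2))) ≤ ((n + 2 : ENNReal) ^ a)⁻¹ := by
  -- `(1 + 1 / d) ^ (n + 1) ≥ 1 + (n + 1) / d ≥ 2`, without denominators
  have hbern : ∀ k, d ^ (k + 1) + (k + 1) * d ^ k ≤ (d + 1) ^ (k + 1) := by
    intro k
    induction k with
    | zero => simp
    | succ k ih =>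
      rw [pow_succ (d + 1)]
      have := Nat.mul_le_mul_right (d + 1) ih
      have h2 : d ^ (k + 1 + 1) + (k + 1 + 1) * d ^ (k + 1)
          ≤ (d ^ (k + 1) + (k + 1) * d ^ k) * (d + 1) := by
        rw [pow_succ d (k + 1), pow_succ d k]
        nlinarith [Nat.zero_le ((k + 1) * d ^ k)]
      exact h2.trans this
  have hhalf : d ^ (n + 1) * 2 ≤ q ^ (n + 1) := by
    have h1 := hbern n
    have h2 : (d + 1) ^ (n + 1) ≤ q ^ (n + 1) := Nat.pow_le_pow_left hq _
    have h3 : d ^ (n + 1) ≤ (n + 1) * d ^ n := by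
      rw [pow_succ, mul_comm]
      exact Nat.mul_le_mul_right _ (by omega)
    omega
  have hq0 : (q : ENNReal) ≠ 0 := by exact_mod_cast (by omega : q ≠ 0)
  have h1 : (d / q : ENNReal) ^ (n + 1) ≤ 2⁻¹ := by
    rw [div_eq_mul_inv, mul_pow, ← ENNReal.inv_pow, ENNReal.le_inv_iff_mul_le, mul_right_comm]
    refine le_trans (mul_le_mul_left ?_ _) (ENNReal.mul_inv_le_one ((q : ENNReal) ^ (n + 1)))
    exact_mod_cast hhalf
  have h2 : (2⁻¹ : ENNReal) ^ (n + 2) ≤ (n + 2 : ENNReal)⁻¹ := by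
    rw [← ENNReal.inv_pow, ENNReal.inv_le_inv]
    exact_mod_cast (Nat.lt_two_pow_self (n := n + 2)).le
  calc (d / q : ENNReal) ^ (a * ((n + 1) * (n + 2)))
      = (((d / q : ENNReal) ^ (n + 1)) ^ (n + 2)) ^ a := by
        rw [← pow_mul, ← pow_mul]
        congr 1
        ring
    _ ≤ ((2⁻¹) ^ (n + 2)) ^ a := by gcongr
    _ ≤ ((n + 2 : ENNReal)⁻¹) ^ a := by gcongr
    _ = ((n + 2 : ENNReal) ^ a)⁻¹ := (ENNReal.inv_pow).symm

/-! ### The input -/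

section Input

variable {n p : ℕ} (cls : Fin n → Fin p) (c : Fin p → ℕ)

theorem inputMemory_apply (a i : ℕ) : inputMemory cls c (a, i)
    = (if a = 0 ∧ i = 0 then n else 0) + (if a = 0 ∧ i = 1 then p else 0)
      + (if h : a = 1 ∧ i < p then c ⟨i, h.2⟩ else 0)
      + (if h : a = 2 ∧ i < n then (cls ⟨i, h.2⟩ : ℕ) else 0) := by
  have hsum : ∀ (m b : ℕ) (f : Fin m → ℕ),
      (∑ x : Fin m, Finsupp.single (b, (x : ℕ)) (f x)) (a, i)
        = if h : a = b ∧ i < m then f ⟨i, h.2⟩ else 0 := by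
    intro m b f
    rw [Finsupp.finsetSum_apply]
    split_ifs with h
    · obtain ⟨rfl, hi⟩ := h
      rw [Finset.sum_eq_single_of_mem (⟨i, hi⟩ : Fin m) (Finset.mem_univ _), Finsupp.single_eq_same]
      intro x _ hx
      rw [Finsupp.single_apply, if_neg]
      intro h
      exact hx (Fin.ext (Prod.mk.inj h).2)
    · refine Finset.sum_eq_zero fun x _ => ?_
      rw [Finsupp.single_apply, if_neg]
      intro h'
      obtain ⟨h1, h2⟩ := Prod.mk.inj h'
      exact h ⟨h1.symm, h2 ▸ x.isLt⟩
  rw [inputMemory, Finsupp.add_apply, Finsupp.add_apply, Finsupp.add_apply, hsum, hsum,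
    Finsupp.single_apply, Finsupp.single_apply]
  simp only [Prod.mk.injEq, eq_comm]

theorem inputMemory_bounded {ℓ V : ℕ} (hc : ∀ i, c i ≤ n) (hp : p ≤ n) (hℓ : n + 1 < ℓ)
    (hV : n < V) : (inputMemory cls c).Bounded ℓ V := by
  intro a i h
  rw [inputMemory_apply] at h ⊢
  have h1 : ∀ hi : i < p, c ⟨i, hi⟩ ≤ n := fun _ => hc _
  have h2 : ∀ hi : i < n, (cls ⟨i, hi⟩ : ℕ) < p := fun _ => Fin.isLt _
  rcases a with _ | _ | _ | a
  · by_cases h0 : i = 0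
    · subst h0; simp; omega
    · by_cases h1 : i = 1
      · subst h1; simp; omega
      · simp [h0, h1] at h
  · by_cases hi : i < p
    · have := h1 hi
      simp [hi]; omega
    · simp [hi] at h
  · by_cases hi : i < n
    · have := h2 hi
      simp [hi]; omega
    · simp [hi] at h
  · simp at h

end Input

/-! ### Bases and multilinear monomials -/

/-- For a monomial of a compatible polynomial, the support is a basis if and only if the monomial
is multilinear. -/
theorem isBase_support_iff {n p d : ℕ} {cls : Fin n → Fin p} {c : Fin p → ℕ}
    (hrank : (partitionMatroid cls c).eRank = d) {m : Fin n →₀ ℕ} (hm : ∑ x, m x = d)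
    (hmc : ∀ i, ∑ x with cls x = i, m x = c i) :
    (partitionMatroid cls c).IsBase (m.support : Set (Fin n)) ↔ ∀ x, m x ≤ 1 := by
  have hsupp : ∑ x ∈ m.support, m x = d := by
    rw [← hm]
    exact Finset.sum_subset (Finset.subset_univ _) fun x _ hx => Finsupp.notMem_support_iff.1 hx
  constructor
  · intro hB x
    have hcard : m.support.card = d := by
      have := hB.encard_eq_eRank
      rw [hrank, Set.encard_coe_eq_coe_finsetCard] at this
      exact_mod_cast this
    by_contra hx
    have : ∑ y ∈ m.support, 1 < ∑ y ∈ m.support, m y :=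
      Finset.sum_lt_sum (fun y hy => Nat.one_le_iff_ne_zero.2 (Finsupp.mem_support_iff.1 hy))
        ⟨x, Finsupp.mem_support_iff.2 (by omega), by omega⟩
    rw [hsupp, Finset.sum_const, smul_eq_mul, mul_one, hcard] at this
    exact lt_irrefl _ this
  · intro hle
    have hone : ∀ x ∈ m.support, m x = 1 := fun x hx => by
      have := hle x
      have := Finsupp.mem_support_iff.1 hx
      omega
    have hind : (partitionMatroid cls c).Indep (m.support : Set (Fin n)) := by
      rw [partitionMatroid_indep_iff]
      intro i
      rw [← hmc i, Finset.card_eq_sum_ones]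
      refine (Finset.sum_congr rfl fun x hx => ?_).le.trans
        (Finset.sum_le_sum_of_subset (f := m)
          (Finset.filter_subset_filter _ (Finset.subset_univ _)))
      exact (hone x (Finset.mem_filter.1 hx).1).symm
    refine hind.isBase_of_eRk_ge (Finset.finite_toSet _) ?_
    rw [hind.eRk_eq_encard, hrank, Set.encard_coe_eq_coe_finsetCard, ← hsupp,
      Finset.sum_congr rfl hone, Finset.sum_const, smul_eq_mul, mul_one]

/-! ### The algorithm -/

namespace Program

/-- The number of rounds. -/
def numRounds (a : ℕ) : Expr :=
  .mul (.const a) (.mul (.add (rd 0) (.const 1)) (.add (rd 0) (.const 2)))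

/-- The algorithm: prepare the ownership of the rows, then run independent rounds. -/
def partitionSieve (a : ℕ) : Program := seq prepare (loop (numRounds a) round)

variable {F : Type*} [Field F] [Fintype F] {n p : ℕ} {O : Oracle F n} {ℓ V : ℕ}
  {cls : Fin n → Fin p} {r : ℕ} {c : Fin p → ℕ}

theorem eval_numRounds (a : ℕ) {M : Memory} (hM : M (0, 0) = n) :
    (numRounds a).eval O M = a * ((n + 1) * (n + 2)) := by
  simp [numRounds, Expr.eval, hM]

/-- Time, space and the absence of false positives, for all random choices. -/
theorem ensures_partitionSieve [CharP F 2] (a : ℕ) (hC : Capacity F n ℓ V) {M : Memory}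
    (hn : M (0, 0) = n) (hp : M (0, 1) = p) (hc : ∀ i : Fin p, M (1, (i : ℕ)) = c i)
    (hcls : ∀ x : Fin n, M (2, (x : ℕ)) = cls x) (hr0 : M (6, 0) = 0) (hf0 : M (3, 0) = 0)
    (h1c : ∀ i, 1 ≤ c i) (hcr : ∑ i, c i = r + p) (hrp : r + p ≤ n)
    (hz : Set.InjOn O.dec (Finset.range (p + 1)))
    (hP : ∀ m ∈ O.poly.support, ∑ s, m s = r + p)
    (hPc : ∀ m ∈ O.poly.support, ∀ i, ∑ x with cls x = i, m x = c i) :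
    Ensures O ℓ V (partitionSieve a) ((1200 * a + 100) * (n + 1) ^ 5 * 2 ^ r) M fun M' =>
      M' (3, 0) ≠ 0 → ∃ m ∈ O.poly.support, ∀ x, m x ≤ 1 := by
  apply Ensures.mono (Q := fun M' : Memory =>
    M' (3, 0) ≠ 0 → ∃ m ∈ O.poly.support, ∀ x, m x ≤ 1)
  case h =>
    apply ensures_seq
    refine (ensures_prepare hC hn hp hc hcls hr0 h1c hcr hrp).mono le_rfl ?_
    rintro M₁ _ ⟨own, hprep, _, hown, hf⟩
    apply ensures_loop hC.field (K := a * ((n + 1) * (n + 2)))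
      (fun _ M' => Prepared cls own r M' ∧
        (M' (3, 0) ≠ 0 → ∃ m ∈ O.poly.support, ∀ x, m x ≤ 1))
      (eval_numRounds a hprep.numVars) ⟨hprep, fun h => absurd (hf.trans hf0) h⟩
    · rintro i _ M₂ ⟨hprep₂, hno⟩
      refine (ensures_round hC hprep₂ (by omega) (by omega)).mono le_rfl ?_
      rintro M₃ _ ⟨hprep₃, _, hflag⟩
      refine ⟨hprep₃, fun h => (hflag h).elim hno ?_⟩
      rintro ⟨g, hg⟩
      by_contra hcon
      push Not at hcon
      exact hg (sieveValue_eq_zero hown O.dec hz O.poly hP hPc hcon g)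
    · exact fun _ h => h.2
  case hT =>
    have h1 : 1 ≤ 2 ^ r := Nat.one_le_two_pow
    have h2 : (n + 1) ^ 2 ≤ (n + 1) ^ 5 * 2 ^ r :=
      (Nat.pow_le_pow_right (by omega) (by norm_num)).trans (Nat.le_mul_of_pos_right _ (by omega))
    have h3 : 1 ≤ (n + 1) ^ 3 * 2 ^ r := Nat.mul_pos (by positivity) (by positivity)
    have h4 : (n + 1) * (n + 2) ≤ 2 * (n + 1) ^ 2 := by nlinarith
    have h5 : a * ((n + 1) * (n + 2)) * (500 * (n + 1) ^ 3 * 2 ^ r + 1)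
        ≤ a * (2 * (n + 1) ^ 2) * (600 * ((n + 1) ^ 3 * 2 ^ r)) :=
      Nat.mul_le_mul (Nat.mul_le_mul_left _ h4) (by nlinarith)
    have h6 : a * (2 * (n + 1) ^ 2) * (600 * ((n + 1) ^ 3 * 2 ^ r))
        = 1200 * a * ((n + 1) ^ 5 * 2 ^ r) := by ring
    have h7 : (1200 * a + 100) * (n + 1) ^ 5 * 2 ^ r
        = 1200 * a * ((n + 1) ^ 5 * 2 ^ r) + 100 * ((n + 1) ^ 5 * 2 ^ r) := by ring
    have h8 : 1 ≤ (n + 1) ^ 5 * 2 ^ r := Nat.mul_pos (by positivity) (by positivity)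
    simp only [Expr.cost, numRounds]
    omega
  case hQ => exact fun _ _ h => h

/-- If there is a multilinear monomial, the algorithm misses it with small probability. -/
theorem toOuterMeasure_partitionSieve_le [CharP F 2] (a : ℕ) (hC : Capacity F n ℓ V)
    {s : RunState} (hb : s.mem.Bounded ℓ V)
    (hn : s.mem (0, 0) = n) (hp : s.mem (0, 1) = p) (hc : ∀ i : Fin p, s.mem (1, (i : ℕ)) = c i)
    (hcls : ∀ x : Fin n, s.mem (2, (x : ℕ)) = cls x) (hr0 : s.mem (6, 0) = 0)
    (h1c : ∀ i, 1 ≤ c i) (hcr : ∑ i, c i = r + p) (hrp : r + p ≤ n)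
    (hF : r + p < Fintype.card F)
    (hz : Set.InjOn O.dec (Finset.range (p + 1)))
    (hP : ∀ m ∈ O.poly.support, ∑ s, m s = r + p) (hdeg : O.poly.totalDegree ≤ r + p)
    (hPc : ∀ m ∈ O.poly.support, ∀ i, ∑ x with cls x = i, m x = c i)
    (hyes : ∃ m ∈ O.poly.support, ∀ x, m x ≤ 1) :
    ((partitionSieve a).run O 0 s).toOuterMeasure {s' | s'.mem (3, 0) = 0}
      ≤ ((n + 2 : ENNReal) ^ a)⁻¹ := by
  rw [partitionSieve, run]
  refine (toOuterMeasure_bind_le _ _ (A := Set.univ) (ε := ((n + 2 : ENNReal) ^ a)⁻¹)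
    (fun _ _ h => absurd (Set.mem_univ _) h) ?_).trans
    ((mul_le_mul_left (toOuterMeasure_le_one _ _) _).trans (one_mul _).le)
  intro t ht _
  obtain ⟨⟨own, hprep, hlt, hown, _⟩, hbt, _⟩ :=
    ensures_prepare hC hn hp hc hcls hr0 h1c hcr hrp 0 s rfl hb t ht
  obtain ⟨m, hm, hle⟩ := hyes
  have hne := exists_sieveValue_ne_zero hown hlt O.dec hz O.poly hP hPc hm hle
  rw [run, eval_numRounds a hprep.numVars]
  refine (toOuterMeasure_repeatRun_round_le hC hdeg (by omega) (by omega) hne _ _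
    (t.charge _ _) hprep hbt).trans ?_
  exact failure_pow_le a hrp hF

end Program

/-- The bound on the space of a run, as a polynomial in the size of the input. -/
theorem space_bound_le {n q w Y : ℕ} (hY : Y = n + 1 + q.size) :
    memoryCap ((n + 1) * (n + 1) + 1) (q + 2 ^ n + (n + 1) * (n + 1) + 1)
        + w * ((q + 2 ^ n + (n + 1) * (n + 1) + 1).size + 1)
      ≤ (2000 + 20 * w) * Y ^ 5 := by
  have hself : (n + 1).size ≤ n + 1 := Nat.size_le.2 Nat.lt_two_pow_self
  have hone : (1 : ℕ).size = 1 := Nat.size_one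
  have hsq := size_mul_le (n + 1) (n + 1)
  have hpow : (2 ^ n).size = n + 1 := Nat.size_pow
  have hℓ := size_add_le ((n + 1) * (n + 1)) 1
  have h1 := size_add_le q (2 ^ n)
  have h2 := size_add_le (q + 2 ^ n) ((n + 1) * (n + 1))
  have h3 := size_add_le (q + 2 ^ n + (n + 1) * (n + 1)) 1
  have hℓ' : ((n + 1) * (n + 1) + 1).size ≤ 4 * Y := by omega
  have hV' : (q + 2 ^ n + (n + 1) * (n + 1) + 1).size + 1 ≤ 9 * Y := by omega
  have hY1 : 1 ≤ Y := by omega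
  have hnY : n + 1 ≤ Y := by omega
  have hA : 32 * ((n + 1) * (n + 1) + 1) ≤ 64 * (Y * Y) := by
    have := Nat.mul_le_mul hnY hnY
    have := Nat.mul_le_mul hY1 hY1
    omega
  have hB : memoryCap ((n + 1) * (n + 1) + 1) (q + 2 ^ n + (n + 1) * (n + 1) + 1)
      ≤ 64 * (Y * Y) * (20 * Y) := Nat.mul_le_mul hA (by omega)
  have h35 : Y ^ 3 ≤ Y ^ 5 := Nat.pow_le_pow_right hY1 (by norm_num)
  have h15 : Y ≤ Y ^ 5 := Nat.le_self_pow (by norm_num) Y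
  have hD := Nat.mul_le_mul_left w (hV'.trans (Nat.mul_le_mul_left 9 h15))
  have hE : 64 * (Y * Y) * (20 * Y) = 1280 * Y ^ 3 := by ring
  nlinarith

theorem mainTheorem3 (a : ℕ) :
    ∃ (A : Program) (C k : ℕ),
      ∀ (F : Type*) [Field F] [Fintype F] [CharP F 2] (n p d : ℕ)
        (cls : Fin n → Fin p) (c : Fin p → ℕ) (O : Oracle F n),
        d < Fintype.card F →
        ∑ i, c i = d →
        (partitionMatroid cls c).eRank = d →
        O.poly.IsHomogeneous d →
        Compatible O.poly cls c →
        (∀ s ∈ (A.exec O cls c).support,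
          s.time ≤ C * (n + 1) ^ k * 2 ^ (d - p) ∧
          s.space ≤ C * (n + 1 + Nat.size (Fintype.card F)) ^ k) ∧
        1 - ((n + 2 : ENNReal) ^ a)⁻¹ ≤
          (A.exec O cls c).toOuterMeasure
            {s | s.saysYes ↔
              ∃ m ∈ O.poly.support, (partitionMatroid cls c).IsBase (m.support : Set (Fin n))} := by
  refine ⟨Program.partitionSieve a,
    1200 * a + 100 + (2000 + 20 * (Program.partitionSieve a).weight), 5, ?_⟩
  intro F _ _ _ n p d cls c O hF hcd hrank hhom hcomp
  obtain ⟨h1c, hPc⟩ := hcomp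
  have hdn : d ≤ n := by
    have h1 := (partitionMatroid cls c).eRank_le_encard_ground.trans
      (Set.encard_le_encard (Set.subset_univ _))
    rw [hrank, Set.encard_univ, ENat.card_eq_coe_fintype_card, Fintype.card_fin] at h1
    exact_mod_cast h1
  have hpd : p ≤ d := by
    rw [← hcd]
    simpa using Finset.sum_le_sum fun i (_ : i ∈ Finset.univ) => h1c i
  obtain ⟨r, rfl⟩ : ∃ r, d = r + p := ⟨d - p, by omega⟩
  rw [Nat.add_sub_cancel]
  have hP : ∀ m ∈ O.poly.support, ∑ s, m s = r + p := by
    intro m hm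
    have := hhom (MvPolynomial.mem_support_iff.1 hm)
    rw [← this, Finsupp.weight_apply, Finsupp.sum_fintype _ _ (by simp)]
    simp
  have hbase : (∃ m ∈ O.poly.support, (partitionMatroid cls c).IsBase (m.support : Set (Fin n)))
      ↔ ∃ m ∈ O.poly.support, ∀ x, m x ≤ 1 :=
    exists_congr fun m => and_congr_right fun hm => isBase_support_iff hrank (hP m hm) (hPc m hm)
  -- the nodes of the interpolation are the field elements with the numbers `0, …, p`
  have hz : Set.InjOn O.dec (Finset.range (p + 1)) := by
    intro i hi j hj hij
    have hi' : i < Fintype.card F := by have := Finset.mem_range.1 (Finset.mem_coe.1 hi); omega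
    have hj' : j < Fintype.card F := by have := Finset.mem_range.1 (Finset.mem_coe.1 hj); omega
    rw [Oracle.dec, Oracle.dec, dif_pos hi', dif_pos hj'] at hij
    exact congrArg Fin.val (O.code.symm.injective hij)
  have hcn : ∀ i, c i ≤ n := fun i =>
    (Finset.single_le_sum (fun _ _ => Nat.zero_le _) (Finset.mem_univ i)).trans (hcd.trans_le hdn)
  have hsq : n + 1 ≤ (n + 1) * (n + 1) := Nat.le_mul_self _
  have htwo : 1 ≤ 2 ^ n := Nat.one_le_two_pow
  have hC : Capacity F n ((n + 1) * (n + 1) + 1)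
      (Fintype.card F + 2 ^ n + (n + 1) * (n + 1) + 1) :=
    ⟨by omega, by omega, by omega, by omega⟩
  have hb : (inputMemory cls c).Bounded ((n + 1) * (n + 1) + 1)
      (Fintype.card F + 2 ^ n + (n + 1) * (n + 1) + 1) :=
    inputMemory_bounded cls c hcn (by omega) (by omega) (by omega)
  have hin : inputMemory cls c (0, 0) = n ∧ inputMemory cls c (0, 1) = p ∧
      (∀ i : Fin p, inputMemory cls c (1, (i : ℕ)) = c i) ∧
      (∀ x : Fin n, inputMemory cls c (2, (x : ℕ)) = cls x) ∧
      inputMemory cls c (6, 0) = 0 ∧ inputMemory cls c (3, 0) = 0 := by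
    simp [inputMemory_apply]
  obtain ⟨h00, h01, h1, h2, h6, h3⟩ := hin
  have hens := Program.ensures_partitionSieve (O := O) a hC h00 h01 h1 h2 h6 h3 h1c hcd hdn hz
    hP hPc 0 ⟨inputMemory cls c, 0, (inputMemory cls c).bits⟩ rfl hb
  constructor
  · intro s hs
    obtain ⟨_, _, htime, hspace⟩ := hens s hs
    constructor
    · refine (htime.trans (Nat.zero_add _).le).trans ?_
      exact Nat.mul_le_mul_right _ (Nat.mul_le_mul_right _ (Nat.le_add_right _ _))
    · have h5 := space_bound_le (n := n) (q := Fintype.card F)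
        (w := (Program.partitionSieve a).weight) rfl
      refine (hspace.trans (max_le (hb.bits_le.trans (Nat.le_add_right _ _)) ?_)).trans
        (h5.trans (Nat.mul_le_mul_right _ (Nat.le_add_left _ _)))
      rw [zero_add]
  · rw [tsub_le_iff_right]
    set good := {s : RunState | s.saysYes ↔
      ∃ m ∈ O.poly.support, (partitionMatroid cls c).IsBase (m.support : Set (Fin n))}
    have hbad : ((Program.partitionSieve a).exec O cls c).toOuterMeasure goodᶜ
        ≤ ((n + 2 : ENNReal) ^ a)⁻¹ := by
      by_cases hyes : ∃ m ∈ O.poly.support, ∀ x, m x ≤ 1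
      · refine le_trans (MeasureTheory.measure_mono ?_)
          (Program.toOuterMeasure_partitionSieve_le (O := O)
            (s := ⟨inputMemory cls c, 0, (inputMemory cls c).bits⟩) a hC hb h00 h01 h1 h2 h6 h1c
            hcd hdn hF hz hP hhom.totalDegree_le hPc hyes)
        intro s hs
        by_contra hne
        exact hs ⟨fun _ => hbase.2 hyes, fun _ => hne⟩
      · refine le_of_eq_of_le ?_ zero_le
        rw [PMF.toOuterMeasure_apply_eq_zero_iff, Set.disjoint_left]
        intro s hs hsbad
        have hno : ¬ s.saysYes := fun h => hyes ((hens s hs).1 h)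
        exact hsbad ⟨fun h => absurd h hno, fun h => absurd (hbase.1 h) hyes⟩
    have htop : ((Program.partitionSieve a).exec O cls c).toOuterMeasure Set.univ = 1 := by
      rw [PMF.toOuterMeasure_apply_eq_one_iff]
      exact Set.subset_univ _
    rw [← htop, ← Set.union_compl_self good]
    exact (MeasureTheory.measure_union_le _ _).trans (add_le_add_right hbad _)
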